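/- Let $d\ge 3$ and $n,m\ge 1$ be integers. A bicritical polynomial of degree $d$ is an $f\in\mathbb{C}[z]$ of degree $d$ with exactly two critical points in $\mathbb{C}$. Let $\mathcal{B}_d^{\mathrm{crit}}$ be the moduli space of bicritical polynomials of degree $d$ with marked critical points: its points are the equivalence classes of triples $(f,c_1,c_2)$, where $f$ is a bicritical polynomial of degree $d$ with (distinct) critical points $c_1,c_2$, and two triples are equivalent if an affine map $\phi$ conjugates one polynomial to the other and sends the first (second) marked point to the first (second) marked point. Every class has exactly one representative with $c_1=0$, $c_2=1$, and this representative is $$f=a\,\mathcal{B}_{d,k}+c,\qquad \mathcal{B}_{d,k}(z)=\sum_{i=0}^{k}(-1)^{k-i}\Bigl[\prod_{0\le j\le k,\ j\ne i}(d-j)\Bigr]\frac{1}{(k-i)!\,i!}\,z^{d-i},$$ for exactly one triple $(k,a,c)$ with $1\le k\le d-2$, $a\in\mathbb{C}\setminus\{0\}$, $c\in\mathbb{C}$; thus $(a,c)$ are coordinates on the component of $\mathcal{B}_d^{\mathrm{crit}}$ given by $k$. Let $$C_{d,0,n}=\{f\in\mathcal{B}_d^{\mathrm{crit}} : f^n(0)=0\},\qquad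 C_{d,1,m}=\{f\in\mathcal{B}_d^{\mathrm{crit}} : f^m(1)=1\},$$ where each class is represented by its representative $f$ with marked critical points $0,1$. Then the curves $C_{d,0,n}$ and $C_{d,1,m}$ intersect transversely: at every point of $C_{d,0,n}\cap C_{d,1,m}$, in the coordinates $(a,c)$ of the component containing the point, the Jacobian determinant $$\det\begin{pmatrix}\partial_a f^n(0) & \partial_c f^n(0)\\ \partial_a\,(f^m(1)-1) & \partial_c\,(f^m(1)-1)\end{pmatrix}$$ of the equations of the two curves is nonzero. -/

import Mathlib

open Polynomial

noncomputable section

namespace Bicritical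

/-- A bicritical polynomial of degree `d` over `ℂ` with marked critical points: a triple
`(f, c₁, c₂)` where `c₁ ≠ c₂` are the critical points of `f` in `ℂ`, and there are no others. -/
structure Marked (d : ℕ) where
  poly : ℂ[X]
  c₁ : ℂ
  c₂ : ℂ
  natDegree_eq : poly.natDegree = d
  ne : c₁ ≠ c₂
  critical_iff : ∀ z : ℂ, poly.derivative.eval z = 0 ↔ z = c₁ ∨ z = c₂

/-- The self-map of `ℂ` given by the polynomial. -/
def Marked.map {d : ℕ} (S : Marked d) : ℂ → ℂ := fun z => S.poly.eval z

/-- Two triples are equivalent if an affine map `z ↦ u z + v` conjugates one polynomial to the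
other and respects the marking. (A Möbius map that conjugates a polynomial with two finite
critical points to a polynomial fixes `∞`, so this is also conjugacy under `PGL₂(ℂ)`.) -/
def Marked.Conj {d : ℕ} (S T : Marked d) : Prop :=
  ∃ u v : ℂ, u ≠ 0 ∧ (∀ z, T.map (u * z + v) = u * S.map z + v) ∧
    T.c₁ = u * S.c₁ + v ∧ T.c₂ = u * S.c₂ + v

theorem Marked.Conj.equivalence (d : ℕ) : Equivalence (Marked.Conj (d := d)) where
  refl S := ⟨1, 0, one_ne_zero, by simp, by simp, by simp⟩
  symm := by
    rintro S T ⟨u, v, hu, h, h1, h2⟩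
    refine ⟨u⁻¹, -(u⁻¹ * v), inv_ne_zero hu, fun z => ?_, ?_, ?_⟩
    · have := h (u⁻¹ * z + -(u⁻¹ * v))
      rw [show u * (u⁻¹ * z + -(u⁻¹ * v)) + v = z by field_simp; ring] at this
      rw [this]; field_simp; ring
    · rw [h1]; field_simp; ring
    · rw [h2]; field_simp; ring
  trans := by
    rintro S T U ⟨u, v, hu, h, h1, h2⟩ ⟨u', v', hu', h', h1', h2'⟩
    refine ⟨u' * u, u' * v + v', mul_ne_zero hu' hu, fun z => ?_, ?_, ?_⟩
    · have := h' (u * z + v)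
      rw [h z] at this
      rw [show u' * u * z + (u' * v + v') = u' * (u * z + v) + v' by ring, this]; ring
    · rw [h1', h1]; ring
    · rw [h2', h2]; ring

instance Marked.setoid (d : ℕ) : Setoid (Marked d) := ⟨Marked.Conj, Marked.Conj.equivalence d⟩

/-- The moduli space of bicritical polynomials of degree `d` with marked critical points. -/
def Moduli (d : ℕ) : Type := Quotient (Marked.setoid d)

/-- The class `[(f, c₁, c₂)]`. -/
def Moduli.mk {d : ℕ} (S : Marked d) : Moduli d := Quotient.mk (Marked.setoid d) S

theorem Marked.iterate_conj {d : ℕ} {S T : Marked d} {u v : ℂ}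
    (h : ∀ z, T.map (u * z + v) = u * S.map z + v) (n : ℕ) (z : ℂ) :
    T.map^[n] (u * z + v) = u * S.map^[n] z + v := by
  induction n with
  | zero => rfl
  | succ n ih => rw [Function.iterate_succ_apply', Function.iterate_succ_apply', ih, h]

/-- `(f^n(c₁) - c₁) / (c₂ - c₁)`, which depends only on the class of `(f, c₁, c₂)`. On the
representative with `c₁ = 0`, `c₂ = 1` it is `f^n(0)`. -/
def Moduli.eqn₁ {d : ℕ} (n : ℕ) (x : Moduli d) : ℂ :=
  Quotient.lift (s := Marked.setoid d)
    (fun S : Marked d => (S.map^[n] S.c₁ - S.c₁) / (S.c₂ - S.c₁))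
    (by
      rintro S T ⟨u, v, hu, h, h1, h2⟩
      have hS := sub_ne_zero.mpr S.ne.symm
      simp only [h1, h2, Marked.iterate_conj h]
      rw [show u * S.map^[n] S.c₁ + v - (u * S.c₁ + v) = u * (S.map^[n] S.c₁ - S.c₁) by ring,
        show u * S.c₂ + v - (u * S.c₁ + v) = u * (S.c₂ - S.c₁) by ring,
        mul_div_mul_left _ _ hu]) x

/-- `(f^m(c₂) - c₂) / (c₂ - c₁)`, which depends only on the class of `(f, c₁, c₂)`. On the
representative with `c₁ = 0`, `c₂ = 1` it is `f^m(1) - 1`. -/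
def Moduli.eqn₂ {d : ℕ} (m : ℕ) (x : Moduli d) : ℂ :=
  Quotient.lift (s := Marked.setoid d)
    (fun S : Marked d => (S.map^[m] S.c₂ - S.c₂) / (S.c₂ - S.c₁))
    (by
      rintro S T ⟨u, v, hu, h, h1, h2⟩
      have hS := sub_ne_zero.mpr S.ne.symm
      simp only [h1, h2, Marked.iterate_conj h]
      rw [show u * S.map^[m] S.c₂ + v - (u * S.c₂ + v) = u * (S.map^[m] S.c₂ - S.c₂) by ring,
        show u * S.c₂ + v - (u * S.c₁ + v) = u * (S.c₂ - S.c₁) by ring,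
        mul_div_mul_left _ _ hu]) x

/-- The curve in the moduli space on which the first marked critical point is periodic with
`f^n(c₁) = c₁` (that is, `f^n(0) = 0` when the marked critical points are `0, 1`). -/
def curve₁ (d n : ℕ) : Set (Moduli d) :=
  {x | ∃ S : Marked d, Moduli.mk S = x ∧ S.c₁ = 0 ∧ S.c₂ = 1 ∧ S.map^[n] 0 = 0}

/-- The curve in the moduli space on which the second marked critical point is periodic with
`f^m(c₂) = c₂` (that is, `f^m(1) = 1` when the marked critical points are `0, 1`). -/
def curve₂ (d m : ℕ) : Set (Moduli d) :=
  {x | ∃ S : Marked d, Moduli.mk S = x ∧ S.c₁ = 0 ∧ S.c₂ = 1 ∧ S.map^[m] 1 = 1}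

/-- The normalized single-cycle Belyi polynomial of combinatorial type `(d; d - k, k + 1, d)`. -/
def belyi (d k : ℕ) : ℂ[X] :=
  ∑ i ∈ Finset.range (k + 1),
    C ((-1) ^ (k - i) * (∏ j ∈ (Finset.range (k + 1)).erase i, ((d : ℂ) - j)) *
      (1 / ((k - i).factorial * i.factorial))) * X ^ (d - i)

theorem derivative_belyi {d k : ℕ} (hk : k + 2 ≤ d) :
    (belyi d k).derivative =
      C ((∏ j ∈ Finset.range (k + 1), ((d : ℂ) - j)) / k.factorial) *
        X ^ (d - k - 1) * (1 - X) ^ k := by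
  rw [belyi, derivative_sum, sub_eq_add_neg, add_pow, Finset.mul_sum]
  refine Finset.sum_congr rfl fun i hi => ?_
  have hi' : i ≤ k := by simpa [Nat.lt_succ_iff] using hi
  rw [derivative_C_mul_X_pow, ← Finset.mul_prod_erase _ _ hi, Nat.choose_eq_factorial_div_factorial hi',
    ← C_eq_natCast, Nat.cast_div (Nat.factorial_mul_factorial_dvd_factorial hi')
      (by exact_mod_cast (mul_pos i.factorial_pos (k - i).factorial_pos).ne'), show d - i - 1 = (d - k - 1) + (k - i) by omega, pow_add,
    Nat.cast_sub (by omega : i ≤ d), neg_pow (X : ℂ[X])]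
  have h1 : (k.factorial : ℂ) ≠ 0 := by exact_mod_cast k.factorial_ne_zero
  have h2 : (i.factorial : ℂ) ≠ 0 := by exact_mod_cast i.factorial_ne_zero
  have h3 : ((k - i).factorial : ℂ) ≠ 0 := by exact_mod_cast (k - i).factorial_ne_zero
  rw [show ((-1 : ℂ[X]) ^ (k - i)) = C ((-1 : ℂ) ^ (k - i)) by simp, one_pow, one_mul]
  set P := ∏ j ∈ (Finset.range (k + 1)).erase i, ((d : ℂ) - j)
  have : ((-1 : ℂ)) ^ (k - i) * P * (1 / ((k - i).factorial * i.factorial)) * ((d : ℂ) - i) =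
      (((d : ℂ) - i) * P / k.factorial) * (-1) ^ (k - i) *
        ((k.factorial : ℂ) / ((i.factorial * (k - i).factorial : ℕ) : ℂ)) := by
    push_cast
    field_simp
  rw [this, C_mul, C_mul]
  ring

/-- The possible values of `k`, where the ramification indices of `0` and `1` are
`d - k` and `k + 1`. -/
abbrev RamType (d : ℕ) : Type := {k : ℕ // 1 ≤ k ∧ k + 2 ≤ d}

theorem leading_ne_zero {d k : ℕ} (hk : k + 2 ≤ d) :
    (∏ j ∈ Finset.range (k + 1), ((d : ℂ) - j)) / k.factorial ≠ 0 := by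
  refine div_ne_zero (Finset.prod_ne_zero_iff.mpr fun j hj => ?_)
    (by exact_mod_cast k.factorial_ne_zero)
  have : j < k + 1 := Finset.mem_range.mp hj
  rw [sub_ne_zero]
  exact_mod_cast (by omega : d ≠ j)

/-- The triple `(a 𝓑_{d,k} + c, 0, 1)`. -/
def normalForm {d : ℕ} (k : RamType d) (a : ℂ) (ha : a ≠ 0) (c : ℂ) : Marked d where
  poly := C a * belyi d k + C c
  c₁ := 0
  c₂ := 1
  natDegree_eq := by
    obtain ⟨k, hk1, hk⟩ := k
    have hl := leading_ne_zero hk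
    have h := congrArg natDegree (derivative_belyi hk)
    have hX : (1 - X : ℂ[X]).natDegree = 1 := by
      rw [← natDegree_neg, neg_sub]; simpa using natDegree_X_sub_C (1 : ℂ)
    have hX0 : (1 - X : ℂ[X]) ≠ 0 := by
      intro h0; rw [h0] at hX; simp at hX
    rw [natDegree_mul (mul_ne_zero (C_ne_zero.mpr hl) (pow_ne_zero _ X_ne_zero))
      (pow_ne_zero _ hX0), natDegree_C_mul hl, natDegree_X_pow, natDegree_pow, hX,
      natDegree_derivative] at h
    rw [natDegree_add_C, natDegree_C_mul ha]
    dsimp only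
    omega
  ne := zero_ne_one
  critical_iff z := by
    obtain ⟨k, hk1, hk⟩ := k
    have hl := leading_ne_zero hk
    have e1 : d - k - 1 ≠ 0 := by omega
    have e2 : k ≠ 0 := by omega
    simp only [derivative_add, derivative_mul, derivative_C, derivative_belyi hk, zero_mul,
      zero_add, add_zero, eval_mul, eval_C, eval_pow, eval_X, eval_sub, eval_one, mul_eq_zero, ha,
      hl, false_or, pow_eq_zero_iff e1, pow_eq_zero_iff e2]
    rw [sub_eq_zero, eq_comm (a := (1 : ℂ))]

/-- The class of `(a 𝓑_{d,k} + c, 0, 1)`. Every point of the moduli space is the class of exactly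
one `(k, a, c)` with `a ≠ 0`, so for each `k` the pair `(a, c)` is a system of coordinates on one
component of the moduli space. -/
def normalClass {d : ℕ} (k : RamType d) (a : ℂ) (ha : a ≠ 0) (c : ℂ) : Moduli d :=
  Moduli.mk (normalForm k a ha c)

open Classical in
/-- A function on the moduli space written in the coordinates `(a, c)` of the component `k`
(and extended by `0` to `a = 0`). -/
def inCoord {d : ℕ} (F : Moduli d → ℂ) (k : RamType d) : ℂ × ℂ → ℂ :=
  fun p => if ha : p.1 ≠ 0 then F (normalClass k p.1 ha p.2) else 0

/-- The matrix of partial derivatives of a pair of functions of two variables. -/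
def jacobian (F G : ℂ × ℂ → ℂ) (p : ℂ × ℂ) : Matrix (Fin 2) (Fin 2) ℂ :=
  !![fderiv ℂ F p (1, 0), fderiv ℂ F p (0, 1);
     fderiv ℂ G p (1, 0), fderiv ℂ G p (0, 1)]

/-- The curves with equations `F = 0` and `G = 0` are transverse at `x`: `x` lies in a coordinate
system `(a, c)`, and in every such system `F` and `G` are differentiable at `x` and the
determinant of their Jacobian matrix at `x` is nonzero. -/
def TransverseAt {d : ℕ} (F G : Moduli d → ℂ) (x : Moduli d) : Prop :=
  (∃ (k : RamType d) (a : ℂ) (ha : a ≠ 0) (c : ℂ), normalClass k a ha c = x) ∧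
  ∀ (k : RamType d) (a : ℂ) (ha : a ≠ 0) (c : ℂ), normalClass k a ha c = x →
    DifferentiableAt ℂ (inCoord F k) (a, c) ∧ DifferentiableAt ℂ (inCoord G k) (a, c) ∧
    (jacobian (inCoord F k) (inCoord G k) (a, c)).det ≠ 0

/-- The subsets `A` and `B` of the moduli space are the curves with equations `F = 0` and `G = 0`,
and these curves are transverse at all points of intersection. -/
def IntersectTransversely {d : ℕ} (A B : Set (Moduli d)) (F G : Moduli d → ℂ) : Prop :=
  (∀ x, x ∈ A ↔ F x = 0) ∧ (∀ x, x ∈ B ↔ G x = 0) ∧ ∀ x ∈ A ∩ B, TransverseAt F G x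

end Bicritical

end

/-!
The proof is Thurston's rigidity argument, in the form in which Epstein uses it for transversality.

Write `f = a B + c` for the normal form and `x_j = f^j(0)`, `y_j = f^j(1)`. For a deformation
`v` of `f` (`v = B` for `∂_a`, `v = 1` for `∂_c`) the derivative of `f^n(0)` is the sum of
`(f^(n - j))'(x_j) v(x_{j-1})` over `1 ≤ j ≤ n`, and similarly for `f^m(1)`. If the Jacobian
determinant vanished, some nontrivial combination with coefficients `s`, `t` of its rows would be
zero. Let `q dz²` be the quadratic differential with simple poles at the points `x_j`, `y_j`, with
residues `s (f^(n - j))'(x_j)` and `t (f^(m - j))'(y_j)`. The relation for the two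
deformations says that the residues have vanishing zeroth and first moments, so `q = O(|z|⁻³)`
at infinity and `q` is integrable on `ℂ` (`integrable_polarSum`). Its residues at `0` and `1` are
`s` and `t` (`sum_orbitWeight_eq_at_critical`), so it has a pole at a critical point.

The push-forward of `q` along `f` is the sum of `q(z) / f'(z)²` over the fibre `f(z) = w`. It moves
a pole at `x` to `f(x)` and divides the residue by `f'(x)`, creating otherwise only poles at the
critical values (`IsBicritical.hasPolesAt_pushforward_sub`). By the choice of the residues, the
push-forward of `q` and `q` itself differ by some `(α w + β) / ((w - f(0)) (w - f(1)))`; the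
difference is `o(|w|⁻²)` at infinity, so it vanishes and `q` is invariant.

This contradicts the area inequality. By the change of variables formula, the integral over `w` of
the fibre sums of `|q| / |f'|²` is the integral of `|q|` (`exists_fiber_sum_le`), so that in the
triangle inequality `|q(w)| ≤ ∑ |q(z)| / |f'(z)|²` equality must hold almost everywhere. But near
a critical point `c` where `q` has a pole, the single term `|q(z)| / |f'(z)|²` already exceeds
`|q(f(z))|`, because `q(f(z)) f'(z)²` has no pole at `c` (`eventually_norm_polarSum_eval_lt`).
-/

open Polynomial

noncomputable section

namespace Bicritical

/-! ### The area inequality -/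

section

open MeasureTheory Set Filter Topology
open scoped ENNReal

/-- Multiplication by `c` on `ℂ = ℝ²` has determinant `‖c‖²`. -/
theorem det_restrictScalars_toSpanSingleton (c : ℂ) :
    ((ContinuousLinearMap.toSpanSingleton ℂ c).restrictScalars ℝ).det = ‖c‖ ^ 2 := by
  have h := LinearMap.det_restrictScalars (R := ℝ)
    (f := (ContinuousLinearMap.toSpanSingleton ℂ c : ℂ →ₗ[ℂ] ℂ))
  have h2 : LinearMap.det (ContinuousLinearMap.toSpanSingleton ℂ c : ℂ →ₗ[ℂ] ℂ) = c := by
    rw [LinearMap.det_ring]; simp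
  rw [h2] at h
  rw [ContinuousLinearMap.det, ← Complex.normSq_eq_norm_sq]
  rw [Algebra.norm_complex_apply] at h
  exact h

theorem exists_mem_nhds_injOn_of_derivative_ne_zero (f : ℂ[X]) {z : ℂ}
    (hz : f.derivative.eval z ≠ 0) : ∃ V ∈ 𝓝 z, IsOpen V ∧ InjOn (fun w => f.eval w) V := by
  have h := (f.hasStrictDerivAt z).hasStrictFDerivAt_equiv hz
  exact ⟨(h.toOpenPartialHomeomorph _).source,
    (h.toOpenPartialHomeomorph _).open_source.mem_nhds h.mem_toOpenPartialHomeomorph_source,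
    (h.toOpenPartialHomeomorph _).open_source, (h.toOpenPartialHomeomorph _).injOn⟩

/-- The complement of the critical points is a disjoint union of countably many measurable sets
on which the polynomial is injective. -/
theorem exists_measurable_partition_injOn (f : ℂ[X]) (hf : f.derivative ≠ 0) :
    ∃ E : ℕ → Set ℂ, (∀ i, MeasurableSet (E i)) ∧ Pairwise (Function.onFun Disjoint E) ∧
      (∀ i, InjOn (fun w => f.eval w) (E i)) ∧ ⋃ i, E i = {z | f.derivative.eval z ≠ 0} := by
  set U : Set ℂ := {z | f.derivative.eval z ≠ 0}
  have hU : IsOpen U := isOpen_ne_fun f.derivative.continuous continuous_const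
  choose! V hV hVo hVi using fun z (hz : z ∈ U) => exists_mem_nhds_injOn_of_derivative_ne_zero f hz
  obtain ⟨t, htU, htc, ht⟩ := TopologicalSpace.countable_cover_nhdsWithin (s := U) (f := V)
    fun z hz => mem_nhdsWithin_of_mem_nhds (hV z hz)
  have hUne : U.Nonempty := by
    by_contra h
    rw [not_nonempty_iff_eq_empty] at h
    refine hf (Polynomial.funext fun z => ?_)
    by_contra hz
    have : z ∈ U := by simpa [U] using hz
    simp [h] at this
  have htne : t.Nonempty := by
    obtain ⟨z, hz⟩ := hUne
    obtain ⟨x, hx, -⟩ := mem_iUnion₂.mp (ht hz)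
    exact ⟨x, hx⟩
  obtain ⟨e, rfl⟩ := htc.exists_eq_range htne
  have heU : ∀ i, e i ∈ U := fun i => htU ⟨i, rfl⟩
  refine ⟨disjointed fun i => V (e i) ∩ U, fun i => ?_, disjoint_disjointed _, fun i => ?_, ?_⟩
  · exact MeasurableSet.disjointed
      (fun j => ((hVo _ (heU j)).measurableSet.inter hU.measurableSet)) i
  · exact (hVi _ (heU i)).mono ((disjointed_subset _ i).trans inter_subset_left)
  · rw [iUnion_disjointed, ← iUnion_inter, inter_eq_right]
    simpa using ht

/-- The supremum of `φ` over the points of `E` in the fibre of `f` over `w`. If `f` is injective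
on `E`, this is the push-forward of `φ` along `f` restricted to `E`. -/
def fiberSup (f : ℂ → ℂ) (φ : ℂ → ℝ≥0∞) (E : Set ℂ) (w : ℂ) : ℝ≥0∞ :=
  ⨆ z ∈ {z | z ∈ E ∧ f z = w}, φ z

theorem le_fiberSup {f : ℂ → ℂ} {φ : ℂ → ℝ≥0∞} {E : Set ℂ} {z : ℂ} (hz : z ∈ E) :
    φ z ≤ fiberSup f φ E (f z) :=
  le_iSup₂_of_le z ⟨hz, rfl⟩ le_rfl

theorem fiberSup_apply {f : ℂ → ℂ} {φ : ℂ → ℝ≥0∞} {E : Set ℂ} (hf : InjOn f E) {z : ℂ}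
    (hz : z ∈ E) : fiberSup f φ E (f z) = φ z := by
  refine le_antisymm (iSup₂_le fun y hy => ?_) (le_fiberSup hz)
  rw [hf hy.1 hz hy.2]

theorem fiberSup_of_notMem {f : ℂ → ℂ} {φ : ℂ → ℝ≥0∞} {E : Set ℂ} {w : ℂ} (hw : w ∉ f '' E) :
    fiberSup f φ E w = 0 := by
  simp only [fiberSup, ENNReal.iSup_eq_zero]
  exact fun z hz => absurd ⟨z, hz.1, hz.2⟩ hw

theorem measurable_fiberSup {f : ℂ → ℂ} (hf : Continuous f) {φ : ℂ → ℝ≥0∞} (hφ : Measurable φ)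
    {E : Set ℂ} (hE : MeasurableSet E) (hinj : InjOn f E) : Measurable (fiberSup f φ E) := by
  refine measurable_of_Ioi fun a => ?_
  have : fiberSup f φ E ⁻¹' Ioi a = f '' (E ∩ φ ⁻¹' Ioi a) := by
    ext w
    simp only [mem_preimage, mem_Ioi, fiberSup, lt_iSup_iff, mem_image, mem_inter_iff,
      mem_ofPred_eq, exists_prop]
    exact ⟨fun ⟨z, h1, h2⟩ => ⟨z, ⟨h1.1, h2⟩, h1.2⟩, fun ⟨z, h1, h2⟩ => ⟨z, ⟨h1.1, h2⟩, h1.2⟩⟩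
  rw [this]
  exact (hE.inter (hφ measurableSet_Ioi)).image_of_continuousOn_injOn hf.continuousOn
    (hinj.mono inter_subset_left)

/-- A polynomial map does not increase the mass of a quadratic differential: there is a function
`G` with the same integral as `h` which bounds the sum of `h / |f'|²` over the noncritical points
of every fibre. -/
theorem exists_fiber_sum_le (f : ℂ[X]) (hf : f.derivative ≠ 0) {h : ℂ → ℝ≥0∞}
    (hh : Measurable h) :
    ∃ G : ℂ → ℝ≥0∞, Measurable G ∧ ∫⁻ w, G w = ∫⁻ z, h z ∧
      ∀ (w : ℂ) (Z : Finset ℂ), (∀ z ∈ Z, f.eval z = w ∧ f.derivative.eval z ≠ 0) →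
        ∑ z ∈ Z, h z / ‖f.derivative.eval z‖ₑ ^ 2 ≤ G w := by
  obtain ⟨E, hE, hdisj, hinj, hU⟩ := exists_measurable_partition_injOn f hf
  have hEU : ∀ i, ∀ z ∈ E i, f.derivative.eval z ≠ 0 := fun i z hz => by
    have : z ∈ ⋃ i, E i := mem_iUnion_of_mem i hz
    rwa [hU] at this
  set φ : ℂ → ℝ≥0∞ := fun z => h z / ‖f.derivative.eval z‖ₑ ^ 2 with hφd
  have hφ : Measurable φ := hh.div (f.derivative.continuous.measurable.enorm.pow_const 2)
  have hint : ∀ i, ∫⁻ w, fiberSup (fun z => f.eval z) φ (E i) w = ∫⁻ z in E i, h z := fun i => by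
    have hS : MeasurableSet ((fun z => f.eval z) '' E i) :=
      (hE i).image_of_continuousOn_injOn f.continuous.continuousOn (hinj i)
    have h1 := lintegral_image_eq_lintegral_abs_det_fderiv_mul volume (hE i)
      (f' := fun z => (ContinuousLinearMap.toSpanSingleton ℂ (f.derivative.eval z)).restrictScalars
        ℝ) (fun z _ => ((f.hasDerivAt z).hasFDerivAt.restrictScalars ℝ).hasFDerivWithinAt) (hinj i)
      (fiberSup (fun z => f.eval z) φ (E i))
    rw [← lintegral_indicator hS, indicator_eq_self.mpr] at h1
    · rw [h1]
      refine setLIntegral_congr_fun (hE i) fun z hz => ?_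
      rw [fiberSup_apply (hinj i) hz, det_restrictScalars_toSpanSingleton, hφd, abs_of_nonneg
        (by positivity), ENNReal.ofReal_pow (norm_nonneg _), ofReal_norm]
      refine ENNReal.mul_div_cancel ?_ ?_
      · simpa using hEU i z hz
      · exact ENNReal.pow_ne_top (by simp)
    · intro w hw
      by_contra hc
      exact hw (fiberSup_of_notMem hc)
  refine ⟨fun w => ∑' i, fiberSup (fun z => f.eval z) φ (E i) w,
    Measurable.tsum fun i => measurable_fiberSup f.continuous hφ (hE i) (hinj i), ?_, ?_⟩
  · rw [lintegral_tsum fun i =>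
      (measurable_fiberSup f.continuous hφ (hE i) (hinj i)).aemeasurable]
    simp only [hint]
    rw [← lintegral_iUnion hE hdisj, hU]
    have : {z | f.derivative.eval z ≠ 0} =ᵐ[volume] (univ : Set ℂ) := by
      rw [ae_eq_univ]
      have : {z | f.derivative.eval z ≠ 0}ᶜ = {z | f.derivative.IsRoot z} := by
        ext; simp
      rw [this]
      exact (f.derivative.finite_setOfPred_isRoot hf).measure_zero _
    rw [setLIntegral_congr this, setLIntegral_univ]
  · intro w Z hZ
    have hex : ∀ z ∈ Z, ∃ i, z ∈ E i := fun z hz => by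
      rw [← mem_iUnion, hU]; exact (hZ z hz).2
    choose! ι hι using hex
    have hιinj : InjOn ι Z := fun z hz y hy hzy => by
      refine hinj (ι z) (hι z hz) (hzy ▸ hι y hy) ?_
      simp only [(hZ z hz).1, (hZ y hy).1]
    calc ∑ z ∈ Z, φ z ≤ ∑ z ∈ Z, fiberSup (fun z => f.eval z) φ (E (ι z)) w :=
          Finset.sum_le_sum fun z hz => by
            have := le_fiberSup (f := fun z => f.eval z) (φ := φ) (hι z hz)
            rwa [(hZ z hz).1] at this
      _ = ∑ i ∈ Z.image ι, fiberSup (fun z => f.eval z) φ (E i) w :=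
          (Finset.sum_image (f := fun i => fiberSup (fun z => f.eval z) φ (E i) w) hιinj).symm
      _ ≤ _ := ENNReal.sum_le_tsum _

end

/-! ### Quadratic differentials with simple poles -/

section

open MeasureTheory Set Filter Topology Asymptotics
open scoped ENNReal

/-- The rational function `∑ rᵢ / (z - xᵢ)`; the points `xᵢ` may repeat. It stands for the
quadratic differential `∑ rᵢ / (z - xᵢ) dz²`. -/
def polarSum {ι : Type*} [Fintype ι] (r x : ι → ℂ) (z : ℂ) : ℂ := ∑ i, r i / (z - x i)

variable {ι : Type*} [Fintype ι] (r x : ι → ℂ)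

theorem measurable_polarSum : Measurable (polarSum r x) :=
  Finset.measurable_sum _ fun i _ => measurable_const.div (measurable_id.sub_const (x i))

theorem isBigO_cobounded_polarSum : polarSum r x =O[Bornology.cobounded ℂ] fun z => z⁻¹ := by
  unfold polarSum
  refine IsBigO.fun_sum fun i _ => ?_
  have h : (fun z : ℂ => z) =O[Bornology.cobounded ℂ] fun z => z - x i := by
    have := Polynomial.isBigO_cobounded_of_degree_le (R := ℂ) (P := X) (Q := X - C (x i))
      (by rw [degree_X, degree_X_sub_C])
    simpa using this
  have h2 := h.inv_rev
    ((Bornology.eventually_ne_cobounded (0 : ℂ)).mono fun z hz h0 => absurd h0 hz)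
  simpa [div_eq_mul_inv] using h2.const_mul_left (r i)

/-- The first two terms of the expansion at infinity vanish together with the first two moments
of the residues. -/
theorem polarSum_eq_inv_sq_mul (h0 : ∑ i, r i = 0) (h1 : ∑ i, r i * x i = 0) {z : ℂ} (hz : z ≠ 0)
    (hzx : ∀ i, z ≠ x i) :
    polarSum r x z = z⁻¹ ^ 2 * polarSum (fun i => r i * x i ^ 2) x z := by
  have : ∀ i, r i / (z - x i) =
      r i * z⁻¹ + r i * x i * z⁻¹ ^ 2 + z⁻¹ ^ 2 * (r i * x i ^ 2 / (z - x i)) := fun i => by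
    have := sub_ne_zero.mpr (hzx i)
    field_simp
    ring
  simp only [polarSum, this, Finset.sum_add_distrib, ← Finset.sum_mul, h0, h1, ← Finset.mul_sum]
  ring

theorem isBigO_cobounded_polarSum_of_moments (h0 : ∑ i, r i = 0) (h1 : ∑ i, r i * x i = 0) :
    polarSum r x =O[Bornology.cobounded ℂ] fun z => z⁻¹ ^ 3 := by
  have h := ((isBigO_refl (fun z : ℂ => z⁻¹ ^ 2) (Bornology.cobounded ℂ)).mul
    (isBigO_cobounded_polarSum (fun i => r i * x i ^ 2) x))
  refine (h.congr' ?_ ?_)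
  · filter_upwards [Bornology.eventually_ne_cobounded 0,
    eventually_all.2 fun i => Bornology.eventually_ne_cobounded (x i)] with z hz hzx
    exact (polarSum_eq_inv_sq_mul r x h0 h1 hz hzx).symm
  · filter_upwards with z
    ring

theorem locallyIntegrable_inv_sub (a : ℂ) : LocallyIntegrable (fun z : ℂ => (z - a)⁻¹) := by
  have h : LocallyIntegrable (fun z : ℂ => z⁻¹) := by
    refine locallyIntegrable_of_norm_le_rpow (C := 1) (α := 1) ?_ ?_ ?_ ?_
    · simp [Complex.finrank_real_complex]
    · simp [Complex.finrank_real_complex]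
    · filter_upwards with z
      simp [Real.rpow_neg_one]
    · exact measurable_inv.aestronglyMeasurable
  intro z
  obtain ⟨s, hs, hi⟩ := h (z - a)
  have hc : ContinuousAt (fun w : ℂ => w - a) z := by fun_prop
  refine ⟨_, hc.preimage_mem_nhds hs, ?_⟩
  exact ((measurePreserving_sub_right volume a).integrableOn_comp_preimage
    (measurableEmbedding_subRight a)).mpr hi

/-- Integrability at infinity is the decay `O(|z|⁻³)`, which the vanishing moments provide. -/
theorem integrable_polarSum (h0 : ∑ i, r i = 0) (h1 : ∑ i, r i * x i = 0) :
    Integrable (polarSum r x) := by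
  have hloc : LocallyIntegrable (polarSum r x) := by
    refine locallyIntegrable_finsetSum (ε''' := ℂ) _ fun i _ => ?_
    have := (locallyIntegrable_inv_sub (x i)).smul (r i)
    simpa only [div_eq_mul_inv] using! this
  have hg : Integrable fun z : ℂ => (1 + ‖z‖) ^ (-3 : ℝ) :=
    integrable_one_add_norm (by simp [Complex.finrank_real_complex]; norm_num)
  refine hloc.integrable_of_isBigO_cocompact ?_ (hg.integrableAtFilter _)
  rw [← Metric.cobounded_eq_cocompact]
  refine (isBigO_cobounded_polarSum_of_moments r x h0 h1).trans ?_
  refine IsBigO.of_bound 8 ?_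
  filter_upwards [eventually_cobounded_le_norm (E := ℂ) 1] with z hz1
  rw [Real.rpow_neg (by positivity), norm_pow, norm_inv, Real.norm_of_nonneg (by positivity)]
  rw [show (3 : ℝ) = (3 : ℕ) by norm_num, Real.rpow_natCast]
  rw [inv_pow, ← div_eq_mul_inv, inv_le_comm₀ (by positivity) (by positivity), inv_div,
    div_le_iff₀ (by norm_num)]
  calc (1 + ‖z‖) ^ 3 ≤ (2 * ‖z‖) ^ 3 := by gcongr; linarith
    _ = _ := by ring

/-- The residue at `c`. -/
theorem tendsto_sub_mul_polarSum (c : ℂ) :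
    Tendsto (fun z => (z - c) * polarSum r x z) (𝓝[≠] c) (𝓝 (∑ i with x i = c, r i)) := by
  simp only [polarSum, Finset.mul_sum, Finset.sum_filter]
  refine tendsto_finsetSum _ fun i _ => ?_
  by_cases h : x i = c
  · rw [if_pos h, h]
    refine tendsto_const_nhds.congr' ?_
    filter_upwards [self_mem_nhdsWithin] with z hz
    rw [mul_div_cancel₀]
    exact sub_ne_zero.mpr hz
  · rw [if_neg h]
    have : ContinuousAt (fun z => (z - c) * (r i / (z - x i))) c :=
      (continuousAt_id.sub continuousAt_const).mul
        (continuousAt_const.div (continuousAt_id.sub continuousAt_const)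
          (sub_ne_zero.mpr (Ne.symm h)))
    have h2 := this.tendsto
    rw [sub_self, zero_mul] at h2
    exact h2.mono_left nhdsWithin_le_nhds

/-- At a critical point `c` of `f` the differential `f^* (r / (w - x) dw²)` has no pole: in the
coordinate `z` it is `f'(z)² r / (f(z) - x)`, and `f'` vanishes to order `e - 1 ≥ 1` where
`f - f(c)` vanishes to order `e`. -/
theorem tendsto_sub_mul_derivative_sq_div {f : ℂ[X]} (hf : f.derivative ≠ 0) {c : ℂ}
    (hc : f.derivative.eval c = 0) (x : ℂ) :
    Tendsto (fun z => (z - c) * (f.derivative.eval z ^ 2 / (f.eval z - x))) (𝓝[≠] c) (𝓝 0) := by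
  by_cases hx : f.eval c = x
  · have hg0 : f - C x ≠ 0 := by
      intro h
      apply hf
      rw [sub_eq_zero.mp h, derivative_C]
    obtain ⟨u, hu, huc⟩ := exists_eq_pow_rootMultiplicity_mul_and_not_dvd (f - C x) hg0 c
    set e := (f - C x).rootMultiplicity c
    rw [dvd_iff_isRoot, IsRoot.def] at huc
    have he0 : e ≠ 0 := by
      intro h
      apply huc
      rw [h, pow_zero, one_mul] at hu
      rw [← hu]; simp [hx]
    obtain ⟨k, hk⟩ := Nat.exists_eq_succ_of_ne_zero he0
    have hd : f.derivative = (X - C c) ^ k * ((k + 1 : ℂ[X]) * u + (X - C c) * u.derivative) := by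
      have := congrArg derivative hu
      rw [derivative_sub, derivative_C, sub_zero] at this
      rw [this, hk, derivative_mul, derivative_X_sub_C_pow]
      simp
      ring
    have hk0 : k ≠ 0 := by
      rintro rfl
      rw [hd] at hc
      apply huc
      simpa using hc
    set v : ℂ[X] := (k + 1 : ℂ[X]) * u + (X - C c) * u.derivative
    have hlim : Tendsto (fun z => (z - c) ^ k * (v.eval z ^ 2 / u.eval z)) (𝓝[≠] c) (𝓝 0) := by
      have : ContinuousAt (fun z => (z - c) ^ k * (v.eval z ^ 2 / u.eval z)) c :=
        ((continuousAt_id.sub continuousAt_const).pow k).mul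
          ((v.continuous.continuousAt.pow 2).div u.continuous.continuousAt huc)
      have h2 := this.tendsto
      rw [sub_self, zero_pow hk0, zero_mul] at h2
      exact h2.mono_left nhdsWithin_le_nhds
    refine hlim.congr' ?_
    have hune : ∀ᶠ z in 𝓝[≠] c, u.eval z ≠ 0 :=
      (u.continuous.continuousAt.eventually_ne huc).filter_mono nhdsWithin_le_nhds
    filter_upwards [self_mem_nhdsWithin, hune] with z hz huz
    have hzc : z - c ≠ 0 := sub_ne_zero.mpr hz
    have hfz : f.eval z - x = (z - c) ^ (k + 1) * u.eval z := by
      have := congrArg (eval z) hu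
      simpa [hk] using this
    rw [hfz, hd]
    simp only [eval_mul, eval_pow, eval_sub, eval_X, eval_C]
    field_simp
    ring
  · have : ContinuousAt (fun z => (z - c) * (f.derivative.eval z ^ 2 / (f.eval z - x))) c :=
      (continuousAt_id.sub continuousAt_const).mul
        ((f.derivative.continuous.continuousAt.pow 2).div
          (f.continuous.continuousAt.sub continuousAt_const) (sub_ne_zero.mpr hx))
    have h2 := this.tendsto
    rw [sub_self, zero_mul] at h2
    exact h2.mono_left nhdsWithin_le_nhds

/-- A pole of the differential at a critical point is not balanced by its image: on the fibres
through points near `c`, one term of the push-forward alone exceeds the differential. -/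
theorem eventually_norm_polarSum_eval_lt {f : ℂ[X]} (hf : f.derivative ≠ 0) {c : ℂ}
    (hc : f.derivative.eval c = 0) (hres : ∑ i with x i = c, r i ≠ 0) :
    ∀ᶠ z in 𝓝[≠] c, ‖polarSum r x (f.eval z)‖ * ‖f.derivative.eval z‖ ^ 2 < ‖polarSum r x z‖ := by
  have h1 := (tendsto_sub_mul_polarSum r x c).norm
  have h2 : Tendsto (fun z => (z - c) * (f.derivative.eval z ^ 2 * polarSum r x (f.eval z)))
      (𝓝[≠] c) (𝓝 0) := by
    have : ∀ z, (z - c) * (f.derivative.eval z ^ 2 * polarSum r x (f.eval z)) =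
        ∑ i, r i * ((z - c) * (f.derivative.eval z ^ 2 / (f.eval z - x i))) := fun z => by
      simp only [polarSum, Finset.mul_sum]
      exact Finset.sum_congr rfl fun i _ => by ring
    simp only [this]
    have h3 := tendsto_finsetSum Finset.univ fun i (_ : i ∈ Finset.univ) =>
      (tendsto_sub_mul_derivative_sq_div hf hc (x i)).const_mul (r i)
    simpa using h3
  have h3 := h2.norm
  rw [norm_zero] at h3
  filter_upwards [h3.eventually_lt h1 (norm_pos_iff.mpr hres), self_mem_nhdsWithin] with z hz hzc
  have hpos : 0 < ‖z - c‖ := norm_pos_iff.mpr (sub_ne_zero.mpr hzc)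
  rw [norm_mul, norm_mul, norm_mul, norm_pow] at hz
  rw [mul_comm]
  exact lt_of_mul_lt_mul_left hz hpos.le

/-- A quadratic differential `q dz²` with at most simple poles that is integrable on `ℂ` and has a
pole at a critical point of `f` is not invariant under push-forward along `f`. -/
theorem not_forall_sum_eq_polarSum {f : ℂ[X]} (hf : f.derivative ≠ 0)
    (h0 : ∑ i, r i = 0) (h1 : ∑ i, r i * x i = 0) {c : ℂ} (hc : f.derivative.eval c = 0)
    (hres : ∑ i with x i = c, r i ≠ 0) :
    ¬ ∀ᶠ w in cofinite, ∃ Z : Finset ℂ,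
      (∀ z ∈ Z, f.eval z = w ∧ f.derivative.eval z ≠ 0) ∧
      ∑ z ∈ Z, polarSum r x z / f.derivative.eval z ^ 2 = polarSum r x w := by
  intro hinv
  obtain ⟨G, hGm, hGint, hG⟩ := exists_fiber_sum_le f hf (measurable_polarSum r x).enorm
  have hfin : ∫⁻ z, ‖polarSum r x z‖ₑ ≠ ∞ := (integrable_polarSum r x h0 h1).2.ne
  have hle : (fun z => ‖polarSum r x z‖ₑ) ≤ᵐ[volume] G := by
    have hae := (mem_cofinite.mp hinv).measure_zero (volume : Measure ℂ)
    filter_upwards [compl_mem_ae_iff.mpr hae] with w hw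
    obtain ⟨Z, hZ, hsum⟩ := not_not.mp hw
    refine le_trans ?_ (hG w Z hZ)
    rw [← hsum]
    refine (enorm_sum_le _ _).trans (Finset.sum_le_sum fun z hz => ?_)
    rw [div_eq_mul_inv, enorm_mul, enorm_inv (pow_ne_zero 2 (hZ z hz).2), enorm_pow, div_eq_mul_inv]
  have hfreq : ∃ᵐ w : ℂ, ‖polarSum r x w‖ₑ ≠ G w := by
    have hne : ∀ᶠ z in 𝓝[≠] c, f.derivative.eval z ≠ 0 :=
      (f.derivative.finite_setOfPred_isRoot hf).compl_mem_cofinite |> nhdsNE_le_cofinite c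
    have hlt : ∀ᶠ z in 𝓝[≠] c, ‖polarSum r x (f.eval z)‖ₑ ≠ G (f.eval z) := by
      filter_upwards [eventually_norm_polarSum_eval_lt r x hf hc hres, hne] with z hz hz'
      refine (lt_of_lt_of_le ?_ (hG (f.eval z) {z} (by simpa using hz'))).ne
      rw [Finset.sum_singleton, ENNReal.lt_div_iff_mul_lt (by simp [hz']) (by simp)]
      rw [← ofReal_norm, ← ofReal_norm, ← ofReal_norm, ← ENNReal.ofReal_pow (norm_nonneg _),
        ← ENNReal.ofReal_mul (norm_nonneg _)]
      exact ENNReal.ofReal_lt_ofReal_iff_of_nonneg (by positivity) |>.mpr hz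
    obtain ⟨z, hz, hz', hzc⟩ :=
      ((eventually_eventually_nhdsWithin.mpr hlt).and (hne.and self_mem_nhdsWithin)).exists
    rw [isOpen_compl_singleton.nhdsWithin_eq hzc] at hz
    have hmem : {w | ‖polarSum r x w‖ₑ ≠ G w} ∈ 𝓝 (f.eval z) := by
      rw [← (f.hasStrictDerivAt z).map_nhds_eq hz']
      exact hz
    rw [frequently_ae_iff]
    exact (Measure.measure_pos_of_mem_nhds volume hmem).ne'
  exact (lintegral_strict_mono_of_ae_le_of_frequently_ae_lt hGm.aemeasurable hfin hle hfreq).ne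
    hGint.symm

end

/-! ### Push-forward of quadratic differentials -/

section

open Filter Topology Asymptotics

/-- The fibre of `f` over `w`, without multiplicities; it is empty if `f` is the constant `w`. -/
def fiber (f : ℂ[X]) (w : ℂ) : Finset ℂ := (f - C w).roots.toFinset

/-- The coefficient at `w` of the push-forward along `f` of the quadratic differential `q dz²`. -/
def pushforward (f : ℂ[X]) (q : ℂ → ℂ) (w : ℂ) : ℂ :=
  ∑ z ∈ fiber f w, q z / f.derivative.eval z ^ 2

theorem eval_eq_of_mem_fiber {f : ℂ[X]} {w z : ℂ} (hz : z ∈ fiber f w) : f.eval z = w := by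
  rw [fiber, Multiset.mem_toFinset, mem_roots', IsRoot.def, eval_sub, eval_C, sub_eq_zero] at hz
  exact hz.2

theorem card_fiber_le (f : ℂ[X]) (w : ℂ) : (fiber f w).card ≤ f.natDegree :=
  (Multiset.toFinset_card_le _).trans ((card_roots' _).trans (natDegree_sub_C).le)

/-- `w` is not a critical value of `f`. -/
def IsRegular (f : ℂ[X]) (w : ℂ) : Prop := ∀ z, f.eval z = w → f.derivative.eval z ≠ 0

theorem eventually_isRegular {f : ℂ[X]} (hf : f.derivative ≠ 0) :
    ∀ᶠ w in cofinite, IsRegular f w := by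
  have h := ((f.derivative.finite_setOfPred_isRoot hf).image fun z => f.eval z).compl_mem_cofinite
  filter_upwards [h] with w hw z hz hz'
  exact hw ⟨z, hz', hz⟩

theorem card_fiber {f : ℂ[X]} {w : ℂ} (hw : IsRegular f w) :
    (fiber f w).card = f.natDegree := by
  have hnd : (f - C w).roots.Nodup := by
    rw [Multiset.nodup_iff_count_le_one]
    intro z
    rw [count_roots]
    by_contra! h
    have hne : f - C w ≠ 0 := by rintro h0; simp [h0] at h
    obtain ⟨h1, h2⟩ := (one_lt_rootMultiplicity_iff_isRoot hne).mp h
    rw [IsRoot.def, eval_sub, eval_C, sub_eq_zero] at h1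
    simp only [derivative_sub, derivative_C, sub_zero, IsRoot.def] at h2
    exact hw z h1 h2
  rw [fiber, Multiset.toFinset_card_of_nodup hnd,
    ← (IsAlgClosed.splits (f - C w)).natDegree_eq_card_roots, natDegree_sub_C]

theorem derivative_eval_eq_prod {f : ℂ[X]} (hd : 0 < f.natDegree) {w : ℂ} (hw : IsRegular f w)
    {z : ℂ} (hz : z ∈ fiber f w) :
    f.derivative.eval z = f.leadingCoeff * ∏ y ∈ (fiber f w).erase z, (z - y) := by
  have hf0 : f.leadingCoeff ≠ 0 := leadingCoeff_ne_zero.mpr (ne_zero_of_natDegree_gt hd)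
  have h : f - C w = C f.leadingCoeff * Lagrange.nodal (fiber f w) id := by
    have hdeg : (f - C w).degree = f.degree :=
      degree_sub_C (natDegree_pos_iff_degree_pos.mp hd)
    refine eq_of_degree_le_of_eval_finset_eq (fiber f w) ?_ ?_ ?_ ?_
    · rw [hdeg, card_fiber hw]; exact degree_le_natDegree
    · rw [hdeg, degree_C_mul hf0, Lagrange.degree_nodal, card_fiber hw,
        degree_eq_natDegree (ne_zero_of_natDegree_gt hd)]
    · rw [leadingCoeff_mul, leadingCoeff_C, Lagrange.nodal_monic.leadingCoeff, mul_one,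
        leadingCoeff_sub_of_degree_lt]
      exact degree_C_le.trans_lt (natDegree_pos_iff_degree_pos.mp hd)
    · intro y hy
      rw [eval_mul, show y = id y from rfl, Lagrange.eval_nodal_at_node hy, mul_zero, id, eval_sub,
        eval_C, eval_eq_of_mem_fiber hy, sub_self]
  have h2 := congrArg (fun p => p.derivative.eval (id z)) h
  simp only [derivative_sub, derivative_C, sub_zero, derivative_C_mul, eval_mul, eval_C] at h2
  rw [Lagrange.eval_nodal_derivative_eval_node_eq hz, Lagrange.eval_nodal] at h2
  simpa using h2

/-- Euler's formula, the residue theorem for `h / (f - w)`. -/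
theorem sum_fiber_eval_div_derivative {f : ℂ[X]} (hd : 0 < f.natDegree) {w : ℂ}
    (hw : IsRegular f w) {h : ℂ[X]} (hh : h.natDegree < f.natDegree) :
    ∑ z ∈ fiber f w, h.eval z / f.derivative.eval z =
      h.coeff (f.natDegree - 1) / f.leadingCoeff := by
  have := Lagrange.coeff_eq_sum (s := fiber f w) (v := id) Function.injective_id.injOn (P := h)
    (by rw [card_fiber hw]
        exact degree_le_natDegree.trans_lt (by exact_mod_cast hh))
  rw [card_fiber hw] at this
  rw [this, Finset.sum_div]
  refine Finset.sum_congr rfl fun z hz => ?_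
  rw [derivative_eval_eq_prod hd hw hz, div_div, mul_comm f.leadingCoeff]
  rfl

/-- The residue theorem for `1 / ((z - x) (f - w))`. -/
theorem sum_fiber_inv_sub_mul_derivative {f : ℂ[X]} (hd : 0 < f.natDegree) {w : ℂ}
    (hw : IsRegular f w) {x : ℂ} (hx : w ≠ f.eval x) :
    ∑ z ∈ fiber f w, 1 / ((z - x) * f.derivative.eval z) = 1 / (w - f.eval x) := by
  have hlc : f.leadingCoeff ≠ 0 := leadingCoeff_ne_zero.mpr (ne_zero_of_natDegree_gt hd)
  obtain ⟨g, hg⟩ := X_sub_C_dvd_sub_C_eval (a := x) (p := f)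
  have hg0 : g ≠ 0 := by
    rintro rfl
    have := congrArg natDegree hg
    rw [natDegree_sub_C] at this
    simp at this; omega
  have hgd : g.natDegree + 1 = f.natDegree := by
    have := congrArg natDegree hg
    rw [natDegree_sub_C, natDegree_mul (X_sub_C_ne_zero x) hg0, natDegree_X_sub_C] at this
    omega
  have hgl : g.coeff (f.natDegree - 1) = f.leadingCoeff := by
    have := congrArg leadingCoeff hg
    rw [leadingCoeff_mul, leadingCoeff_X_sub_C, one_mul, leadingCoeff_sub_of_degree_lt
      (degree_C_le.trans_lt (natDegree_pos_iff_degree_pos.mp hd))] at this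
    rw [← hgd, Nat.add_sub_cancel, this]; rfl
  have h := sum_fiber_eval_div_derivative hd hw (h := g) (by omega)
  rw [hgl, div_self hlc] at h
  rw [show 1 / (w - f.eval x) = (∑ z ∈ fiber f w, g.eval z / f.derivative.eval z) / (w - f.eval x)
    by rw [h], Finset.sum_div]
  refine Finset.sum_congr rfl fun z hz => ?_
  have h2 := congrArg (eval z) hg
  simp only [eval_sub, eval_C, eval_mul, eval_X, eval_eq_of_mem_fiber hz] at h2
  have h3 : w - f.eval x ≠ 0 := sub_ne_zero.mpr hx
  have h4 := hw z (eval_eq_of_mem_fiber hz)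
  have h5 : z - x ≠ 0 := fun h0 => h3 (by rw [h2, h0, zero_mul])
  rw [div_div, div_eq_div_iff (mul_ne_zero h5 h4) (mul_ne_zero h4 h3), h2]
  ring

/-- `g` agrees, outside a finite set, with a rational function that vanishes at infinity and has no
poles except at most simple ones at `v₀` and `v₁` (at most a double one if `v₀ = v₁`). -/
def HasPolesAt (v₀ v₁ : ℂ) (g : ℂ → ℂ) : Prop :=
  ∃ α β : ℂ, ∀ᶠ w in cofinite, g w = (α * w + β) / ((w - v₀) * (w - v₁))

namespace HasPolesAt

variable {v₀ v₁ : ℂ} {g h : ℂ → ℂ}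

theorem add (hg : HasPolesAt v₀ v₁ g) (hh : HasPolesAt v₀ v₁ h) :
    HasPolesAt v₀ v₁ fun w => g w + h w := by
  obtain ⟨α, β, hg⟩ := hg
  obtain ⟨α', β', hh⟩ := hh
  refine ⟨α + α', β + β', ?_⟩
  filter_upwards [hg, hh] with w h1 h2
  rw [h1, h2]; ring

theorem const_mul (hg : HasPolesAt v₀ v₁ g) (c : ℂ) : HasPolesAt v₀ v₁ fun w => c * g w := by
  obtain ⟨α, β, hg⟩ := hg
  refine ⟨c * α, c * β, ?_⟩
  filter_upwards [hg] with w h1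
  rw [h1]; ring

theorem congr (hg : HasPolesAt v₀ v₁ g) (h' : ∀ᶠ w in cofinite, h w = g w) :
    HasPolesAt v₀ v₁ h := by
  obtain ⟨α, β, hg⟩ := hg
  refine ⟨α, β, ?_⟩
  filter_upwards [hg, h'] with w h1 h2
  rw [h2, h1]

theorem sum {ι : Type*} (s : Finset ι) {g : ι → ℂ → ℂ} (hg : ∀ i ∈ s, HasPolesAt v₀ v₁ (g i)) :
    HasPolesAt v₀ v₁ fun w => ∑ i ∈ s, g i w := by
  classical
  induction s using Finset.induction_on with
  | empty => exact ⟨0, 0, by simp⟩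
  | insert a s ha ih =>
    simp only [Finset.sum_insert ha]
    exact (hg a (by simp)).add (ih fun i hi => hg i (by simp [hi]))

theorem inv_sub_left : HasPolesAt v₀ v₁ fun w => 1 / (w - v₀) := by
  refine ⟨1, -v₁, ?_⟩
  filter_upwards [(Set.finite_singleton v₁).compl_mem_cofinite] with w hw
  have : w - v₁ ≠ 0 := sub_ne_zero.mpr hw
  rw [one_mul, ← sub_eq_add_neg, div_mul_cancel_right₀ this, one_div]

theorem inv_sub_right : HasPolesAt v₀ v₁ fun w => 1 / (w - v₁) := by
  refine ⟨1, -v₀, ?_⟩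
  filter_upwards [(Set.finite_singleton v₀).compl_mem_cofinite] with w hw
  have : w - v₀ ≠ 0 := sub_ne_zero.mpr hw
  rw [one_mul, ← sub_eq_add_neg, mul_comm, div_mul_cancel_right₀ this, one_div]

/-- Poles at `v₀` and `v₁` alone are not compatible with the decay `o(|w|⁻²)` at infinity. -/
theorem eventually_eq_zero (hg : HasPolesAt v₀ v₁ g)
    (h0 : Tendsto (fun w => w ^ 2 * g w) (Bornology.cobounded ℂ) (𝓝 0)) :
    ∀ᶠ w in cofinite, g w = 0 := by
  obtain ⟨α, β, hg⟩ := hg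
  have hinv : Tendsto (fun w : ℂ => w⁻¹) (Bornology.cobounded ℂ) (𝓝 0) :=
    tendsto_inv₀_cobounded
  have hlin : Tendsto (fun w => α * w + β) (Bornology.cobounded ℂ) (𝓝 0) := by
    have h1 : Tendsto (fun w : ℂ => w ^ 2 * g w * ((1 - v₀ * w⁻¹) * (1 - v₁ * w⁻¹)))
        (Bornology.cobounded ℂ) (𝓝 0) := by
      have := h0.mul (((hinv.const_mul v₀).const_sub 1).mul ((hinv.const_mul v₁).const_sub 1))
      simpa using this
    refine h1.congr' ?_
    filter_upwards [hg.filter_mono (Bornology.le_cofinite ℂ), Bornology.eventually_ne_cobounded 0,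
      Bornology.eventually_ne_cobounded v₀, Bornology.eventually_ne_cobounded v₁] with w h2 h3 h4 h5
    have h4' := sub_ne_zero.mpr h4
    have h5' := sub_ne_zero.mpr h5
    rw [h2]
    field_simp
  have hα : α = 0 := by
    have h1 : Tendsto (fun w => (α * w + β) * w⁻¹ - β * w⁻¹) (Bornology.cobounded ℂ) (𝓝 0) := by
      have := (hlin.mul hinv).sub (hinv.const_mul β)
      simpa using this
    refine tendsto_nhds_unique (tendsto_const_nhds.congr' ?_) h1
    filter_upwards [Bornology.eventually_ne_cobounded (0 : ℂ)] with w hw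
    field_simp
    ring
  have hβ : β = 0 := by
    simp only [hα, zero_mul, zero_add] at hlin
    exact tendsto_nhds_unique tendsto_const_nhds hlin
  filter_upwards [hg] with w hw
  rw [hw, hα, hβ]; simp

end HasPolesAt

/-- The push-forward of a differential that is `O(|z|⁻³)` at infinity is `o(|w|⁻²)`. -/
theorem tendsto_sq_mul_pushforward {f : ℂ[X]} (hd : 0 < f.natDegree) {q : ℂ → ℂ}
    (hq : q =O[Bornology.cobounded ℂ] fun z => z⁻¹ ^ 3) :
    Tendsto (fun w => w ^ 2 * pushforward f q w) (Bornology.cobounded ℂ) (𝓝 0) := by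
  have hinv : Tendsto (fun w : ℂ => w⁻¹) (Bornology.cobounded ℂ) (𝓝 0) :=
    tendsto_inv₀_cobounded
  -- Each term of the sum is a value of `ψ`, which is `O(|z|⁻¹)` since `f = O(z f')` at infinity;
  -- the points of the fibre over `w` go to infinity with `w`.
  set ψ : ℂ → ℂ := fun z => f.eval z ^ 2 * (q z / f.derivative.eval z ^ 2) with hψ
  have hdf : f.derivative ≠ 0 := by
    intro h; exact hd.ne' (derivative_eq_zero.mp h)
  have hψ0 : Tendsto ψ (Bornology.cobounded ℂ) (𝓝 0) := by
    have h1 : (fun z => f.eval z) =O[Bornology.cobounded ℂ] fun z => (X * f.derivative).eval z := by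
      refine Polynomial.isBigO_cobounded_of_degree_le ?_
      rw [degree_mul, degree_X, degree_derivative hd.ne',
        degree_eq_natDegree (ne_zero_of_natDegree_gt hd)]
      norm_cast; omega
    have h2 : ψ =O[Bornology.cobounded ℂ] fun z => z⁻¹ := by
      have h3 := (h1.pow 2).mul
        (hq.mul (isBigO_refl (fun z => (f.derivative.eval z ^ 2)⁻¹) (Bornology.cobounded ℂ)))
      simp only [← div_eq_mul_inv] at h3
      refine h3.congr' (Eventually.of_forall fun z => rfl) ?_
      filter_upwards [Bornology.eventually_ne_cobounded (0 : ℂ),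
        (f.derivative.finite_setOfPred_isRoot hdf).compl_mem_cofinite |>
          (Bornology.le_cofinite ℂ)] with z hz hz'
      have hz' : f.derivative.eval z ≠ 0 := hz'
      simp only [eval_mul, eval_X]
      field_simp
    exact h2.trans_tendsto hinv
  rw [Metric.tendsto_nhds] at hψ0 ⊢
  intro ε hε
  have hd' : (0 : ℝ) < f.natDegree + 1 := by positivity
  obtain ⟨R, hR⟩ := (hasBasis_cobounded_norm.eventually_iff).mp (hψ0 (ε / (f.natDegree + 1))
    (by positivity))
  have hK : Bornology.IsBounded ((fun z => f.eval z) '' Metric.closedBall 0 R) :=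
    ((isCompact_closedBall 0 R).image f.continuous).isBounded
  filter_upwards [Bornology.isBounded_def.mp hK] with w hw
  rw [dist_zero_right, pushforward, Finset.mul_sum]
  calc ‖∑ z ∈ fiber f w, w ^ 2 * (q z / f.derivative.eval z ^ 2)‖
      ≤ ∑ z ∈ fiber f w, ε / (f.natDegree + 1) := by
        refine norm_sum_le_of_le _ fun z hz => ?_
        have hzw := eval_eq_of_mem_fiber hz
        have hzR : R ≤ ‖z‖ := by
          by_contra! h
          exact hw ⟨z, by simpa using h.le, hzw⟩
        have := hR.2 hzR
        rw [dist_zero_right, hψ] at this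
        rw [← hzw]
        exact this.le
    _ ≤ f.natDegree * (ε / (f.natDegree + 1)) := by
        rw [Finset.sum_const, nsmul_eq_mul]
        gcongr
        exact card_fiber_le f w
    _ < (f.natDegree + 1) * (ε / (f.natDegree + 1)) := by
        gcongr
        linarith
    _ = ε := by field_simp

end

/-! ### Bicritical polynomials and their push-forwards -/

section

open Filter Topology Asymptotics

theorem exists_sub_C_eval_eq_pow_mul {f : ℂ[X]} (hf : f.derivative ≠ 0) {c : ℂ} {k : ℕ}
    (h : (X - C c) ^ k ∣ f.derivative) : ∃ u, f - C (f.eval c) = (X - C c) ^ (k + 1) * u := by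
  have hd : (f - C (f.eval c)).derivative = f.derivative := by simp
  have hne : f - C (f.eval c) ≠ 0 := by
    intro h0; rw [h0] at hd; exact hf (by rw [← hd, derivative_zero])
  have hr : (f - C (f.eval c)).IsRoot c := by simp
  have h1 := derivative_rootMultiplicity_of_root hr
  rw [hd] at h1
  have h2 := (le_rootMultiplicity_iff hf).mpr h
  have h3 := (rootMultiplicity_pos hne).mpr hr
  exact (le_rootMultiplicity_iff hne).mp (by omega)

/-- A polynomial with exactly the critical points `0` and `1`, of multiplicities `k₀` and `k₁`. -/
structure IsBicritical (f : ℂ[X]) (k₀ k₁ : ℕ) (b : ℂ) : Prop where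
  derivative_eq : f.derivative = C b * X ^ k₀ * (X - 1) ^ k₁
  ne_zero : b ≠ 0
  pos_left : 0 < k₀
  pos_right : 0 < k₁

namespace IsBicritical

variable {f : ℂ[X]} {k₀ k₁ : ℕ} {b : ℂ} (hf : IsBicritical f k₀ k₁ b)
include hf

theorem natDegree_derivative_eq : f.derivative.natDegree = k₀ + k₁ := by
  have h1 : (X - 1 : ℂ[X]) = X - C 1 := by simp
  rw [hf.derivative_eq, h1, natDegree_mul, natDegree_C_mul hf.ne_zero, natDegree_X_pow,
    natDegree_pow, natDegree_X_sub_C, mul_one]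
  · exact mul_ne_zero (C_ne_zero.mpr hf.ne_zero) (pow_ne_zero _ X_ne_zero)
  · exact pow_ne_zero _ (X_sub_C_ne_zero 1)

theorem natDegree_eq : f.natDegree = k₀ + k₁ + 1 := by
  have h := hf.natDegree_derivative_eq
  have := hf.pos_left
  rw [natDegree_derivative] at h
  omega

theorem natDegree_pos : 0 < f.natDegree := by rw [hf.natDegree_eq]; omega

theorem derivative_ne_zero : f.derivative ≠ 0 := by
  intro h
  have := hf.natDegree_derivative_eq
  have := hf.pos_left
  simp [h] at *
  omega

theorem derivative_eval (z : ℂ) : f.derivative.eval z = b * z ^ k₀ * (z - 1) ^ k₁ := by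
  rw [hf.derivative_eq]; simp

theorem derivative_eval_eq_zero_iff (z : ℂ) : f.derivative.eval z = 0 ↔ z = 0 ∨ z = 1 := by
  rw [hf.derivative_eval]
  simp [hf.ne_zero, hf.pos_left.ne', hf.pos_right.ne', sub_eq_zero]

/-- A differential whose only poles in `ℂ` are simple poles at the critical points is pushed forward
to one with poles only at the critical values, provided that it is of smaller order than `f'` at
infinity. -/
theorem hasPolesAt_pushforward_div (M : ℂ[X]) (hM : M.natDegree ≤ k₀ + k₁ + 1) :
    HasPolesAt (f.eval 0) (f.eval 1) (pushforward f fun z => M.eval z / (z * (z - 1))) := by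
  have hb := hf.ne_zero
  have hd := hf.natDegree_pos
  obtain ⟨u₀, hu₀⟩ := exists_sub_C_eval_eq_pow_mul hf.derivative_ne_zero (c := 0) (k := k₀)
    ⟨C b * (X - 1) ^ k₁, by rw [hf.derivative_eq, C_0]; ring⟩
  obtain ⟨u₁, hu₁⟩ := exists_sub_C_eval_eq_pow_mul hf.derivative_ne_zero (c := 1) (k := k₁)
    ⟨C b * X ^ k₀, by rw [hf.derivative_eq, C_1]; ring⟩
  have hdeg : ∀ {c : ℂ} {k : ℕ} {u : ℂ[X]}, f - C (f.eval c) = (X - C c) ^ k * u →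
      u.natDegree + k = f.natDegree := fun {c k u} h => by
    have hu : u ≠ 0 := by
      rintro rfl
      have := congrArg natDegree h
      rw [natDegree_sub_C] at this
      simp at this; omega
    have := congrArg natDegree h
    rw [natDegree_sub_C, natDegree_mul (pow_ne_zero _ (X_sub_C_ne_zero c)) hu, natDegree_pow,
      natDegree_X_sub_C] at this
    omega
  have hdeg₀ := hdeg hu₀
  have hdeg₁ := hdeg hu₁
  have hfd := hf.natDegree_eq
  -- On the fibre over `w`, where `1 / (z (z - 1) f') = 1 / (b z ^ (k₀ + 1) (z - 1) ^ (k₁ + 1))`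
  -- equals `u₀ u₁ / (b (w - f 0) (w - f 1))`, the values of `M u₀ u₁ / b = f Q + R` are those of
  -- the polynomial `w Q + R` of degree less than that of `f`.
  set P := C b⁻¹ * M * u₀ * u₁
  set Q := P / f
  set R := P % f
  have hP : P.natDegree < f.natDegree + f.natDegree := by
    have h1 : P.natDegree ≤ M.natDegree + u₀.natDegree + u₁.natDegree := by
      refine natDegree_mul_le.trans (Nat.add_le_add_right (natDegree_mul_le.trans ?_) _)
      exact Nat.add_le_add_right (natDegree_C_mul_le _ _) _
    omega
  have hf0 : f ≠ 0 := ne_zero_of_natDegree_gt hd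
  have hR : R.natDegree < f.natDegree := natDegree_mod_lt _ hd.ne'
  have hPQR : f * Q + R = P := EuclideanDomain.div_add_mod P f
  have hQ : Q.natDegree < f.natDegree := by
    by_cases hQ0 : Q = 0
    · rwa [hQ0, natDegree_zero]
    have h1 := natDegree_sub_le P R
    rw [← hPQR, add_sub_cancel_right, natDegree_mul hf0 hQ0, hPQR] at h1
    omega
  refine ⟨Q.coeff (f.natDegree - 1) / f.leadingCoeff, R.coeff (f.natDegree - 1) / f.leadingCoeff,
    ?_⟩
  filter_upwards [eventually_isRegular hf.derivative_ne_zero,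
    (Set.finite_singleton (f.eval 0)).compl_mem_cofinite,
    (Set.finite_singleton (f.eval 1)).compl_mem_cofinite] with w hw hw0 hw1
  have hw0 : w - f.eval 0 ≠ 0 := sub_ne_zero.mpr hw0
  have hw1 : w - f.eval 1 ≠ 0 := sub_ne_zero.mpr hw1
  have e := congrArg₂ (fun s t => w * s + t) (sum_fiber_eval_div_derivative hd hw hQ)
    (sum_fiber_eval_div_derivative hd hw hR)
  rw [Finset.mul_sum, ← Finset.sum_add_distrib] at e
  rw [show ∀ s t u : ℂ, s / t * w + u / t = w * (s / t) + u / t from fun s t u => by ring, ← e,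
    Finset.sum_div, pushforward]
  refine Finset.sum_congr rfl fun z hz => ?_
  have hzw := eval_eq_of_mem_fiber hz
  have h' := hw z hzw
  have h0 := congrArg (eval z) hu₀
  have h1 := congrArg (eval z) hu₁
  have h2 := congrArg (eval z) hPQR
  simp only [P, eval_sub, eval_C, eval_mul, eval_pow, eval_X, eval_add, hzw, sub_zero] at h0 h1 h2
  have hz0 : z ^ (k₀ + 1) ≠ 0 := fun h => hw0 (by rw [h0, h, zero_mul])
  have hz1 : (z - 1) ^ (k₁ + 1) ≠ 0 := fun h => hw1 (by rw [h1, h, zero_mul])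
  rw [show w * (Q.eval z / f.derivative.eval z) + R.eval z / f.derivative.eval z =
    (w * Q.eval z + R.eval z) / f.derivative.eval z by ring, h2, h0, h1]
  rw [h0] at hw0
  rw [h1] at hw1
  have hu0 := right_ne_zero_of_mul hw0
  have hu1 := right_ne_zero_of_mul hw1
  have hz00 : z ≠ 0 := fun h => hz0 (by rw [h, zero_pow k₀.succ_ne_zero])
  have hz11 : z - 1 ≠ 0 := fun h => hz1 (by rw [h, zero_pow k₁.succ_ne_zero])
  have hfz := hf.derivative_eval z
  rw [hfz] at h' ⊢
  field_simp
  ring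

theorem hasPolesAt_pushforward_of_eq {q : ℂ → ℂ} (M : ℂ[X]) (hM : M.natDegree ≤ k₀ + k₁ + 1)
    (hq : ∀ z, z ≠ 0 → z - 1 ≠ 0 → q z = M.eval z / (z * (z - 1))) :
    HasPolesAt (f.eval 0) (f.eval 1) (pushforward f q) := by
  refine (hf.hasPolesAt_pushforward_div M hM).congr ?_
  filter_upwards [eventually_isRegular hf.derivative_ne_zero] with w hw
  refine Finset.sum_congr rfl fun z hz => ?_
  have h := hw z (eval_eq_of_mem_fiber hz)
  rw [Ne, hf.derivative_eval_eq_zero_iff, not_or] at h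
  rw [hq z h.1 (sub_ne_zero.mpr h.2)]

/-- A simple pole at a critical point is pushed forward to the critical values. -/
theorem hasPolesAt_pushforward_inv_sub {c : ℂ} (hc : f.derivative.eval c = 0) :
    HasPolesAt (f.eval 0) (f.eval 1) (pushforward f fun z => 1 / (z - c)) := by
  rcases (hf.derivative_eval_eq_zero_iff c).mp hc with rfl | rfl
  · refine hf.hasPolesAt_pushforward_of_eq (X - C 1) ?_ fun z h0 h1 => ?_
    · rw [natDegree_X_sub_C]; omega
    · simp only [eval_C, eval_sub, eval_X, sub_zero]
      field_simp
  · refine hf.hasPolesAt_pushforward_of_eq X ?_ fun z h0 h1 => ?_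
    · rw [natDegree_X]; omega
    · rw [eval_X]
      field_simp

/-- A simple pole at `x` is pushed forward to a simple pole at `f(x)` whose residue is that at `x`
divided by `f'(x)`, up to poles at the critical values. -/
theorem hasPolesAt_pushforward_sub (x : ℂ) :
    HasPolesAt (f.eval 0) (f.eval 1) fun w =>
      f.derivative.eval x * pushforward f (fun z => 1 / (z - x)) w - 1 / (w - f.eval x) := by
  by_cases hx : f.derivative.eval x = 0
  · simp only [hx, zero_mul, zero_sub]
    have h : HasPolesAt (f.eval 0) (f.eval 1) fun w => 1 / (w - f.eval x) := by
      rcases (hf.derivative_eval_eq_zero_iff x).mp hx with rfl | rfl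
      exacts [HasPolesAt.inv_sub_left, HasPolesAt.inv_sub_right]
    simpa only [neg_one_mul] using h.const_mul (-1)
  · -- `f'(x) / ((z - x) f'²) = 1 / ((z - x) f') - g / f'²` with `f' - f'(x) = (z - x) g`
    obtain ⟨g, hg⟩ := X_sub_C_dvd_sub_C_eval (a := x) (p := f.derivative)
    have hgd : g.natDegree + 1 ≤ k₀ + k₁ := by
      have h0 := hf.pos_left
      by_cases hg0 : g = 0
      · rw [hg0, natDegree_zero]; omega
      have := congrArg natDegree hg
      rw [natDegree_sub_C, hf.natDegree_derivative_eq,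
        natDegree_mul (X_sub_C_ne_zero x) hg0, natDegree_X_sub_C] at this
      omega
    have h := hf.hasPolesAt_pushforward_of_eq (q := fun z => -g.eval z)
      (-(X * (X - C 1)) * g) ?_ fun z h0 h1 => ?_
    · refine h.congr ?_
      filter_upwards [eventually_isRegular hf.derivative_ne_zero,
        (Set.finite_singleton (f.eval x)).compl_mem_cofinite] with w hw hwx
      rw [← sum_fiber_inv_sub_mul_derivative hf.natDegree_pos hw hwx, pushforward, pushforward,
        Finset.mul_sum, ← Finset.sum_sub_distrib]
      refine Finset.sum_congr rfl fun z hz => ?_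
      have hz' := hw z (eval_eq_of_mem_fiber hz)
      have hzx : z - x ≠ 0 := sub_ne_zero.mpr fun h => hwx (by
        rw [Set.mem_singleton_iff, ← eval_eq_of_mem_fiber hz, h])
      have h2 := congrArg (eval z) hg
      simp only [eval_sub, eval_C, eval_mul, eval_X] at h2
      rw [show f.derivative.eval x = f.derivative.eval z - (z - x) * g.eval z by
        linear_combination -h2]
      field_simp
      ring
    · refine natDegree_mul_le.trans ?_
      have h1 : (-(X * (X - C 1)) : ℂ[X]).natDegree ≤ 2 := by
        rw [natDegree_neg]
        refine natDegree_mul_le.trans ?_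
        rw [natDegree_X, natDegree_X_sub_C]
      omega
    · simp only [eval_mul, eval_neg, eval_C, eval_X, eval_sub]
      field_simp

end IsBicritical

end

/-! ### The invariant differential of a pair of critical orbits -/

section

open Filter Topology Asymptotics Finset

/-- The derivative of `f^(n - j)` at the `j`-th point of the orbit of `z`. -/
def orbitWeight (f : ℂ[X]) (z : ℂ) (n j : ℕ) : ℂ :=
  ∏ i ∈ Ico j n, f.derivative.eval ((fun y => f.eval y)^[i] z)

theorem orbitWeight_self (f : ℂ[X]) (z : ℂ) (n : ℕ) : orbitWeight f z n n = 1 := by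
  simp [orbitWeight]

theorem orbitWeight_eq_mul (f : ℂ[X]) (z : ℂ) {n j : ℕ} (h : j < n) :
    orbitWeight f z n j =
      f.derivative.eval ((fun y => f.eval y)^[j] z) * orbitWeight f z n (j + 1) :=
  prod_eq_prod_Ico_succ_bot h _

theorem orbitWeight_succ (f : ℂ[X]) (z : ℂ) {n j : ℕ} (h : j ≤ n) :
    orbitWeight f z (n + 1) j =
      f.derivative.eval ((fun y => f.eval y)^[n] z) * orbitWeight f z n j := by
  rw [orbitWeight, prod_Ico_succ_top h, mul_comm, orbitWeight]

/-- The quadratic differential with a simple pole at each point `f^j(z)`, `1 ≤ j ≤ n`, of residue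
`(f^(n - j))'(f^j(z))`. It pairs with a vector field `v` to the derivative of `f^n(z)` along the
deformation `v` of `f`. -/
def orbitPolar (f : ℂ[X]) (z : ℂ) (n : ℕ) (w : ℂ) : ℂ :=
  ∑ j ∈ range n, orbitWeight f z n (j + 1) / (w - (fun y => f.eval y)^[j + 1] z)

/-- The sum of the residues of `orbitPolar` at a critical point `c`: the weight of a visit to `c`
before time `n` vanishes, whether or not `n` is the exact period. -/
theorem sum_orbitWeight_eq_at_critical {f : ℂ[X]} {z c : ℂ} {n : ℕ} (hn : 1 ≤ n)
    (hz : (fun y => f.eval y)^[n] z = z) (hc : f.derivative.eval c = 0) :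
    (∑ j ∈ range n, if (fun y => f.eval y)^[j + 1] z = c then orbitWeight f z n (j + 1) else 0) =
      if z = c then 1 else 0 := by
  obtain ⟨N, rfl⟩ := Nat.exists_eq_add_of_le' hn
  rw [sum_range_succ, hz, orbitWeight_self, sum_eq_zero, zero_add]
  intro j hj
  split_ifs with h
  · rw [orbitWeight_eq_mul f z (by simpa using hj), h, hc, zero_mul]
  · rfl

/-- The first moment of the residues when `f` is an affine function of `B`. -/
theorem sum_orbitWeight_mul_iterate (B : ℂ[X]) (a c z : ℂ) (n : ℕ) :
    ∑ j ∈ range n, orbitWeight (C a * B + C c) z n (j + 1) *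
        (fun y => (C a * B + C c).eval y)^[j + 1] z =
      a * ∑ j ∈ range n, orbitWeight (C a * B + C c) z n (j + 1) *
        B.eval ((fun y => (C a * B + C c).eval y)^[j] z) +
      c * ∑ j ∈ range n, orbitWeight (C a * B + C c) z n (j + 1) := by
  rw [mul_sum, mul_sum, ← sum_add_distrib]
  refine sum_congr rfl fun j _ => ?_
  rw [Function.iterate_succ_apply']
  simp only [eval_add, eval_mul, eval_C]
  ring

theorem pushforward_add (f : ℂ[X]) (p q : ℂ → ℂ) (w : ℂ) :
    pushforward f (fun z => p z + q z) w = pushforward f p w + pushforward f q w := by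
  simp only [pushforward, add_div, sum_add_distrib]

theorem pushforward_const_mul (f : ℂ[X]) (c : ℂ) (q : ℂ → ℂ) (w : ℂ) :
    pushforward f (fun z => c * q z) w = c * pushforward f q w := by
  simp only [pushforward, mul_div_assoc, mul_sum]

theorem pushforward_sum (f : ℂ[X]) {ι : Type*} (s : Finset ι) (q : ι → ℂ → ℂ) (w : ℂ) :
    pushforward f (fun z => ∑ i ∈ s, q i z) w = ∑ i ∈ s, pushforward f (q i) w := by
  simp only [pushforward, sum_div]
  exact sum_comm

/-- The differential of a critical orbit is invariant under push-forward up to poles at the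
critical values: `f` moves each pole to the next point of the orbit. -/
theorem IsBicritical.hasPolesAt_pushforward_orbitPolar_sub {f : ℂ[X]} {k₀ k₁ : ℕ} {b : ℂ}
    (hf : IsBicritical f k₀ k₁ b) {z : ℂ} (hc : f.derivative.eval z = 0) {n : ℕ} (hn : 1 ≤ n)
    (hz : (fun y => f.eval y)^[n] z = z) :
    HasPolesAt (f.eval 0) (f.eval 1) fun w =>
      pushforward f (orbitPolar f z n) w - orbitPolar f z n w := by
  obtain ⟨N, rfl⟩ := Nat.exists_eq_add_of_le' hn
  set x : ℕ → ℂ := fun j => (fun y => f.eval y)^[j] z with hx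
  have hxs : ∀ j, f.eval (x j) = x (j + 1) := fun j => by
    simp only [hx, Function.iterate_succ_apply']
  set W := orbitWeight f z (N + 1)
  have h1 : orbitPolar f z (N + 1) = fun w =>
      (∑ j ∈ range N, W (j + 2) * f.derivative.eval (x (j + 1)) * (1 / (w - x (j + 1)))) +
        1 / (w - z) := by
    funext w
    rw [orbitPolar, sum_range_succ, orbitWeight_self, hz]
    congr 1
    refine sum_congr rfl fun j hj => ?_
    rw [orbitWeight_eq_mul f z (by simpa using hj)]
    ring
  have h2 : ∀ w, orbitPolar f z (N + 1) w =
      (∑ j ∈ range N, W (j + 2) * (1 / (w - f.eval (x (j + 1))))) +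
        W 1 * (1 / (w - f.eval z)) := fun w => by
    rw [orbitPolar, sum_range_succ']
    congr 1
    · refine sum_congr rfl fun j hj => ?_
      rw [hxs, mul_one_div]
    · rw [mul_one_div]; rfl
  have h3 : HasPolesAt (f.eval 0) (f.eval 1) fun w => 1 / (w - f.eval z) := by
    rcases (hf.derivative_eval_eq_zero_iff z).mp hc with rfl | rfl
    exacts [HasPolesAt.inv_sub_left, HasPolesAt.inv_sub_right]
  refine (((HasPolesAt.sum (range N) fun j _ =>
    (hf.hasPolesAt_pushforward_sub (x (j + 1))).const_mul (W (j + 2))).add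
    (hf.hasPolesAt_pushforward_inv_sub hc)).add (h3.const_mul (-W 1))).congr
    (Eventually.of_forall fun w => ?_)
  rw [h2, h1, pushforward_add, pushforward_sum]
  simp only [pushforward_const_mul, mul_sub, sum_sub_distrib, mul_assoc]
  ring

/-- The dual form of transversality: if both critical points are periodic, no nontrivial combination
of the differentials of their orbits is integrable at infinity: such a combination would be an
integrable differential, invariant under push-forward, with a pole at a critical point. -/
theorem IsBicritical.eq_zero_of_moments {f : ℂ[X]} {k₀ k₁ : ℕ} {b : ℂ}
    (hf : IsBicritical f k₀ k₁ b) {n m : ℕ} (hn : 1 ≤ n) (hm : 1 ≤ m)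
    (h0 : (fun y => f.eval y)^[n] 0 = 0) (h1 : (fun y => f.eval y)^[m] 1 = 1) {s t : ℂ}
    (hm0 : s * ∑ j ∈ range n, orbitWeight f 0 n (j + 1) +
      t * ∑ j ∈ range m, orbitWeight f 1 m (j + 1) = 0)
    (hm1 : s * ∑ j ∈ range n, orbitWeight f 0 n (j + 1) * (fun y => f.eval y)^[j + 1] 0 +
      t * ∑ j ∈ range m, orbitWeight f 1 m (j + 1) * (fun y => f.eval y)^[j + 1] 1 = 0) :
    s = 0 ∧ t = 0 := by
  have hc0 := (hf.derivative_eval_eq_zero_iff 0).mpr (Or.inl rfl)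
  have hc1 := (hf.derivative_eval_eq_zero_iff 1).mpr (Or.inr rfl)
  set r : Fin n ⊕ Fin m → ℂ := Sum.elim (fun j => s * orbitWeight f 0 n (j + 1))
    (fun j => t * orbitWeight f 1 m (j + 1)) with hr
  set x : Fin n ⊕ Fin m → ℂ := Sum.elim (fun j => (fun y => f.eval y)^[j + 1] 0)
    (fun j => (fun y => f.eval y)^[j + 1] 1) with hx
  have hr0 : ∑ i, r i = 0 := by
    rw [Fintype.sum_sum_type]
    simp only [hr, Sum.elim_inl, Sum.elim_inr, ← mul_sum]
    rw [Fin.sum_univ_eq_sum_range (fun j => orbitWeight f 0 n (j + 1)),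
      Fin.sum_univ_eq_sum_range (fun j => orbitWeight f 1 m (j + 1)), hm0]
  have hr1 : ∑ i, r i * x i = 0 := by
    rw [Fintype.sum_sum_type]
    simp only [hr, hx, Sum.elim_inl, Sum.elim_inr, mul_assoc, ← mul_sum]
    rw [Fin.sum_univ_eq_sum_range (fun j => orbitWeight f 0 n (j + 1) *
        (fun y => f.eval y)^[j + 1] 0),
      Fin.sum_univ_eq_sum_range (fun j => orbitWeight f 1 m (j + 1) *
        (fun y => f.eval y)^[j + 1] 1), hm1]
  have hq : polarSum r x = fun w => s * orbitPolar f 0 n w + t * orbitPolar f 1 m w := by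
    funext w
    rw [polarSum, Fintype.sum_sum_type]
    simp only [hr, hx, Sum.elim_inl, Sum.elim_inr, mul_div_assoc, ← mul_sum]
    rw [Fin.sum_univ_eq_sum_range (fun j => orbitWeight f 0 n (j + 1) /
        (w - (fun y => f.eval y)^[j + 1] 0)),
      Fin.sum_univ_eq_sum_range (fun j => orbitWeight f 1 m (j + 1) /
        (w - (fun y => f.eval y)^[j + 1] 1))]
    rfl
  have hres : ∀ c, f.derivative.eval c = 0 →
      ∑ i with x i = c, r i = s * (if 0 = c then 1 else 0) + t * (if 1 = c then 1 else 0) := by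
    intro c hc
    rw [sum_filter, Fintype.sum_sum_type]
    simp only [hr, hx, Sum.elim_inl, Sum.elim_inr, ← mul_ite_zero, ← mul_sum]
    rw [Fin.sum_univ_eq_sum_range (fun j => if (fun y => f.eval y)^[j + 1] 0 = c then
        orbitWeight f 0 n (j + 1) else 0),
      Fin.sum_univ_eq_sum_range (fun j => if (fun y => f.eval y)^[j + 1] 1 = c then
        orbitWeight f 1 m (j + 1) else 0), sum_orbitWeight_eq_at_critical hn h0 hc,
      sum_orbitWeight_eq_at_critical hm h1 hc]
  have hdecay := isBigO_cobounded_polarSum_of_moments r x hr0 hr1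
  have hpoles : HasPolesAt (f.eval 0) (f.eval 1) fun w =>
      pushforward f (polarSum r x) w - polarSum r x w := by
    refine (((hf.hasPolesAt_pushforward_orbitPolar_sub hc0 hn h0).const_mul s).add
      ((hf.hasPolesAt_pushforward_orbitPolar_sub hc1 hm h1).const_mul t)).congr
      (Eventually.of_forall fun w => ?_)
    rw [hq, pushforward_add, pushforward_const_mul, pushforward_const_mul]
    ring
  have hinv := hpoles.eventually_eq_zero (by
    have h2 : Tendsto (fun w => w ^ 2 * polarSum r x w) (Bornology.cobounded ℂ) (𝓝 0) := by
      have h3 := (isBigO_refl (fun w : ℂ => w ^ 2) (Bornology.cobounded ℂ)).mul hdecay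
      refine (h3.congr' (Eventually.of_forall fun w => rfl) ?_).trans_tendsto
        tendsto_inv₀_cobounded
      filter_upwards [Bornology.eventually_ne_cobounded (0 : ℂ)] with w hw
      field_simp
    simpa [mul_sub] using (tendsto_sq_mul_pushforward hf.natDegree_pos hdecay).sub h2)
  have hfib : ∀ᶠ w in cofinite, ∃ Z : Finset ℂ,
      (∀ z ∈ Z, f.eval z = w ∧ f.derivative.eval z ≠ 0) ∧
      ∑ z ∈ Z, polarSum r x z / f.derivative.eval z ^ 2 = polarSum r x w := by
    filter_upwards [hinv, eventually_isRegular hf.derivative_ne_zero] with w hw hreg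
    exact ⟨fiber f w, fun z hz => ⟨eval_eq_of_mem_fiber hz, hreg z (eval_eq_of_mem_fiber hz)⟩,
      sub_eq_zero.mp hw⟩
  have key : ∀ c, f.derivative.eval c = 0 →
      s * (if 0 = c then 1 else 0) + t * (if 1 = c then 1 else 0) = 0 := by
    intro c hc
    by_contra h
    rw [← hres c hc] at h
    exact not_forall_sum_eq_polarSum r x hf.derivative_ne_zero hr0 hr1 hc h hfib
  have k0 := key 0 hc0
  have k1 := key 1 hc1
  simp only [one_ne_zero, zero_ne_one, if_true, if_false] at k0 k1
  exact ⟨by simpa using k0, by simpa using k1⟩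

/-- The derivative of `f^n(z)` in the coordinates `(a, c)` of `f = a B + c`. -/
theorem hasFDerivAt_iterate (B : ℂ[X]) (z : ℂ) (n : ℕ) (p : ℂ × ℂ) :
    HasFDerivAt (fun p : ℂ × ℂ => (fun y => (C p.1 * B + C p.2).eval y)^[n] z)
      (∑ j ∈ range n, orbitWeight (C p.1 * B + C p.2) z n (j + 1) •
        (B.eval ((fun y => (C p.1 * B + C p.2).eval y)^[j] z) • ContinuousLinearMap.fst ℂ ℂ ℂ +
          ContinuousLinearMap.snd ℂ ℂ ℂ)) p := by
  induction n with
  | zero => simpa using hasFDerivAt_const z p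
  | succ n ih =>
    simp only [Function.iterate_succ_apply', eval_add, eval_mul, eval_C]
    simp only [eval_add, eval_mul, eval_C] at ih
    have h1 := (B.hasDerivAt _).comp_hasFDerivAt p ih
    have h2 := ((hasFDerivAt_fst (𝕜 := ℂ) (p := p)).mul h1).add
      (hasFDerivAt_snd (𝕜 := ℂ) (p := p))
    refine h2.congr_fderiv ?_
    rw [sum_range_succ, orbitWeight_self, one_smul]
    have h3 : ∑ j ∈ range n, orbitWeight (C p.1 * B + C p.2) z (n + 1) (j + 1) •
        (B.eval ((fun y => p.1 * B.eval y + p.2)^[j] z) • ContinuousLinearMap.fst ℂ ℂ ℂ +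
          ContinuousLinearMap.snd ℂ ℂ ℂ) = (p.1 * B.derivative.eval
            ((fun y => p.1 * B.eval y + p.2)^[n] z)) •
        ∑ j ∈ range n, orbitWeight (C p.1 * B + C p.2) z n (j + 1) •
        (B.eval ((fun y => p.1 * B.eval y + p.2)^[j] z) • ContinuousLinearMap.fst ℂ ℂ ℂ +
          ContinuousLinearMap.snd ℂ ℂ ℂ) := by
      rw [smul_sum]
      refine sum_congr rfl fun j hj => ?_
      rw [orbitWeight_succ _ _ (by simpa using hj), smul_smul]
      simp
    rw [h3, mul_smul]
    exact add_assoc _ _ _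

end

/-! ### The moduli space in coordinates -/

section

open Filter Topology

theorem eqn₁_mk {d : ℕ} (n : ℕ) (S : Marked d) :
    (Moduli.mk S).eqn₁ n = (S.map^[n] S.c₁ - S.c₁) / (S.c₂ - S.c₁) := rfl

theorem eqn₂_mk {d : ℕ} (m : ℕ) (S : Marked d) :
    (Moduli.mk S).eqn₂ m = (S.map^[m] S.c₂ - S.c₂) / (S.c₂ - S.c₁) := rfl

/-- Every class has a representative with critical points `0` and `1`. -/
theorem exists_normalized {d : ℕ} (y : Moduli d) :
    ∃ S : Marked d, Moduli.mk S = y ∧ S.c₁ = 0 ∧ S.c₂ = 1 := by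
  obtain ⟨S, rfl⟩ := Quotient.exists_rep y
  have hne : S.c₂ - S.c₁ ≠ 0 := sub_ne_zero.mpr S.ne.symm
  set L : ℂ := S.c₂ - S.c₁ with hL
  have hnd : (C L * X + C S.c₁ : ℂ[X]).natDegree = 1 := natDegree_linear hne
  let T : Marked d :=
    { poly := C L⁻¹ * (S.poly.comp (C L * X + C S.c₁) - C S.c₁)
      c₁ := 0
      c₂ := 1
      natDegree_eq := by
        rw [natDegree_C_mul (inv_ne_zero hne), natDegree_sub_C, natDegree_comp, hnd, mul_one,
          S.natDegree_eq]
      ne := zero_ne_one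
      critical_iff := fun z => by
        have h1 : z = 0 ↔ L * z + S.c₁ = S.c₁ := by simp [hne]
        have h2 : z = 1 ↔ L * z + S.c₁ = S.c₂ := by
          rw [← eq_sub_iff_add_eq, ← hL, mul_eq_left₀ hne]
        rw [h1, h2, ← S.critical_iff]
        simp [derivative_comp, hne] }
  refine ⟨T, Quotient.sound' ?_, rfl, rfl⟩
  refine ⟨L, S.c₁, hne, fun z => ?_, by simp [T], by simp [T, hL]⟩
  simp only [Marked.map, T, eval_mul, eval_C, eval_sub, eval_comp, eval_add, eval_X]
  field_simp
  ring

theorem mem_curve₁_iff {d n : ℕ} (y : Moduli d) : y ∈ curve₁ d n ↔ y.eqn₁ n = 0 := by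
  constructor
  · rintro ⟨S, rfl, h1, h2, h⟩
    rw [eqn₁_mk, h1, h2, h]; simp
  · intro h
    obtain ⟨S, rfl, h1, h2⟩ := exists_normalized y
    refine ⟨S, rfl, h1, h2, ?_⟩
    rw [eqn₁_mk, h1, h2] at h
    simpa using h

theorem mem_curve₂_iff {d m : ℕ} (y : Moduli d) : y ∈ curve₂ d m ↔ y.eqn₂ m = 0 := by
  constructor
  · rintro ⟨S, rfl, h1, h2, h⟩
    rw [eqn₂_mk, h1, h2, h]; simp
  · intro h
    obtain ⟨S, rfl, h1, h2⟩ := exists_normalized y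
    refine ⟨S, rfl, h1, h2, ?_⟩
    rw [eqn₂_mk, h1, h2] at h
    simpa [sub_eq_zero] using h

theorem exists_eq_C_mul_pow_mul_pow {p : ℂ[X]} (h : ∀ z, p.eval z = 0 ↔ z = 0 ∨ z = 1) :
    ∃ (b : ℂ) (i j : ℕ), b ≠ 0 ∧ i ≠ 0 ∧ j ≠ 0 ∧ p = C b * X ^ i * (1 - X) ^ j := by
  have hp : p ≠ 0 := by
    rintro rfl
    have := (h 2).mp eval_zero
    norm_num at this
  obtain ⟨u, hu, hu0⟩ := exists_eq_pow_rootMultiplicity_mul_and_not_dvd p hp 0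
  have hu' : u ≠ 0 := by rintro rfl; exact hu0 (dvd_zero _)
  obtain ⟨v, hv, hv1⟩ := exists_eq_pow_rootMultiplicity_mul_and_not_dvd u hu' 1
  rw [dvd_iff_isRoot, IsRoot.def] at hu0 hv1
  have hv0 : v.eval 0 ≠ 0 := fun h0 => hu0 (by rw [hv, eval_mul, h0, mul_zero])
  have hvc : v.degree = 0 := by
    by_contra hdeg
    obtain ⟨z, hz⟩ := IsAlgClosed.exists_root v hdeg
    rcases (h z).mp (by rw [hu, hv, eval_mul, eval_mul, hz.eq_zero, mul_zero, mul_zero])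
      with rfl | rfl
    exacts [hv0 hz, hv1 hz]
  have hvC := eq_C_of_degree_eq_zero hvc
  have hb : v.coeff 0 ≠ 0 := fun h0 => hv0 (by rw [hvC, h0]; simp)
  refine ⟨v.coeff 0 * (-1) ^ u.rootMultiplicity 1, p.rootMultiplicity 0, u.rootMultiplicity 1,
    mul_ne_zero hb (pow_ne_zero _ (by norm_num)), ?_, ?_, ?_⟩
  · exact ((rootMultiplicity_pos hp).mpr ((h 0).mpr (Or.inl rfl))).ne'
  · refine ((rootMultiplicity_pos hu').mpr ?_).ne'
    have h1 := (h 1).mpr (Or.inr rfl)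
    rw [hu, eval_mul] at h1
    exact (mul_eq_zero.mp h1).resolve_left (by simp)
  · rw [show (1 - X : ℂ[X]) = C (-1) * (X - C 1) by simp, mul_pow, C_mul, C_pow]
    nth_rewrite 1 [hu, hv, hvC]
    rw [C_0, sub_zero, mul_mul_mul_comm, ← mul_assoc]
    have : (C (-1 : ℂ)) ^ u.rootMultiplicity 1 * (C (-1)) ^ u.rootMultiplicity 1 = 1 := by
      rw [← mul_pow, ← C_mul]; simp
    linear_combination -(X ^ p.rootMultiplicity 0 * (X - C 1) ^ u.rootMultiplicity 1 *
      C (v.coeff 0)) * this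

theorem natDegree_C_mul_pow_mul_pow {b : ℂ} (hb : b ≠ 0) (i j : ℕ) :
    (C b * X ^ i * (1 - X) ^ j : ℂ[X]).natDegree = i + j := by
  have hX : (1 - X : ℂ[X]).natDegree = 1 := by
    rw [← natDegree_neg, neg_sub]; simpa using natDegree_X_sub_C (1 : ℂ)
  have hX0 : (1 - X : ℂ[X]) ≠ 0 := by
    intro h0; rw [h0] at hX; simp at hX
  rw [natDegree_mul (mul_ne_zero (C_ne_zero.mpr hb) (pow_ne_zero _ X_ne_zero))
    (pow_ne_zero _ hX0), natDegree_C_mul hb, natDegree_X_pow, natDegree_pow, hX, mul_one]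

/-- Every class has a representative in normal form: the derivative of a normalized bicritical
polynomial is a multiple of `X ^ i * (1 - X) ^ j`, hence of the derivative of `belyi d j`. -/
theorem exists_normalClass {d : ℕ} (y : Moduli d) :
    ∃ (k : RamType d) (a : ℂ) (ha : a ≠ 0) (c : ℂ), normalClass k a ha c = y := by
  obtain ⟨S, rfl, h1, h2⟩ := exists_normalized y
  have hS := S.critical_iff
  rw [h1, h2] at hS
  obtain ⟨b, i, j, hb, hi, hj, hp⟩ := exists_eq_C_mul_pow_mul_pow hS
  have hd : i + j + 1 = d := by
    have := congrArg natDegree hp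
    rw [natDegree_C_mul_pow_mul_pow hb, natDegree_derivative, S.natDegree_eq] at this
    omega
  have hk : j + 2 ≤ d := by omega
  have hl := leading_ne_zero hk
  set l := (∏ s ∈ Finset.range (j + 1), ((d : ℂ) - s)) / j.factorial
  set q : ℂ[X] := S.poly - C (b / l) * belyi d j
  have hq : q.derivative = 0 := by
    rw [derivative_sub, hp, derivative_C_mul, derivative_belyi hk, show d - j - 1 = i by omega,
      ← mul_assoc, ← mul_assoc, ← C_mul, div_mul_cancel₀ _ hl, sub_self]
  have hq2 : q = C (q.coeff 0) := eq_C_of_natDegree_eq_zero (derivative_eq_zero.mp hq)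
  refine ⟨⟨j, by omega, hk⟩, b / l, div_ne_zero hb hl, q.coeff 0, Quotient.sound' ?_⟩
  refine ⟨1, 0, one_ne_zero, fun z => ?_, ?_, ?_⟩
  · simp only [Marked.map, one_mul, add_zero, normalForm]
    rw [← hq2]
    simp [q]
  · simp [normalForm, h1]
  · simp [normalForm, h2]

theorem isBicritical_normalForm {d : ℕ} (k : RamType d) {a : ℂ} (ha : a ≠ 0) (c : ℂ) :
    ∃ b, IsBicritical (C a * belyi d k + C c) (d - k - 1) k b := by
  obtain ⟨k, hk1, hk⟩ := k
  have hl := leading_ne_zero hk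
  refine ⟨a * ((∏ j ∈ Finset.range (k + 1), ((d : ℂ) - j)) / k.factorial) * (-1) ^ k,
    ?_, mul_ne_zero (mul_ne_zero ha hl) (pow_ne_zero _ (by norm_num)), ?_, hk1⟩
  · rw [derivative_add, derivative_C, add_zero, derivative_C_mul, derivative_belyi hk,
      show (1 - X : ℂ[X]) = C (-1) * (X - 1) by simp, mul_pow, C_mul, C_mul, C_pow]
    ring
  · show 0 < d - k - 1
    omega

theorem inCoord_eqn₁_eventuallyEq {d : ℕ} (n : ℕ) (k : RamType d) {p : ℂ × ℂ} (hp : p.1 ≠ 0) :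
    inCoord (Moduli.eqn₁ n) k =ᶠ[𝓝 p]
      fun p => (fun z => (C p.1 * belyi d k + C p.2).eval z)^[n] 0 := by
  filter_upwards [continuous_fst.continuousAt.eventually_ne hp] with p hp
  rw [inCoord, dif_pos hp, normalClass, eqn₁_mk]
  simp only [normalForm, sub_zero, div_one]
  rfl

theorem inCoord_eqn₂_eventuallyEq {d : ℕ} (m : ℕ) (k : RamType d) {p : ℂ × ℂ} (hp : p.1 ≠ 0) :
    inCoord (Moduli.eqn₂ m) k =ᶠ[𝓝 p]
      fun p => (fun z => (C p.1 * belyi d k + C p.2).eval z)^[m] 1 - 1 := by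
  filter_upwards [continuous_fst.continuousAt.eventually_ne hp] with p hp
  rw [inCoord, dif_pos hp, normalClass, eqn₂_mk]
  simp only [normalForm, sub_zero, div_one]
  rfl

/-- A singular Jacobian matrix has a relation between its rows, that is, a combination of the
differentials of the two critical orbits that annihilates the deformations `1` and `B` of
`a B + c`; this makes the first two moments of its residues vanish. -/
theorem transverseAt_of_eqn_eq_zero {d n m : ℕ} (hn : 1 ≤ n) (hm : 1 ≤ m) {y : Moduli d}
    (h1 : y.eqn₁ n = 0) (h2 : y.eqn₂ m = 0) :
    TransverseAt (Moduli.eqn₁ n) (Moduli.eqn₂ m) y := by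
  refine ⟨exists_normalClass y, ?_⟩
  rintro k a ha c rfl
  obtain ⟨b, hf⟩ := isBicritical_normalForm k ha c
  rw [normalClass, eqn₁_mk] at h1
  rw [normalClass, eqn₂_mk] at h2
  simp only [normalForm, sub_zero, div_one] at h1 h2
  rw [sub_eq_zero] at h2
  have hF := (hasFDerivAt_iterate (belyi d k) 0 n (a, c)).congr_of_eventuallyEq
    (inCoord_eqn₁_eventuallyEq n k (p := (a, c)) ha)
  have hG := ((hasFDerivAt_iterate (belyi d k) 1 m (a, c)).sub_const 1).congr_of_eventuallyEq
    (inCoord_eqn₂_eventuallyEq m k (p := (a, c)) ha)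
  refine ⟨hF.differentiableAt, hG.differentiableAt, fun hdet => ?_⟩
  obtain ⟨v, hv, hvM⟩ := Matrix.exists_vecMul_eq_zero_iff.mpr hdet
  have e0 := congrFun hvM 0
  have e1 := congrFun hvM 1
  simp only [jacobian, Matrix.vecMul, dotProduct, Fin.sum_univ_two, hF.fderiv, hG.fderiv,
    Matrix.of_apply, Matrix.cons_val_zero, Matrix.cons_val_one, Matrix.cons_val',
    Matrix.cons_val_fin_one, Pi.zero_apply, sum_apply, smul_apply, add_apply, smul_eq_mul,
    mul_one, mul_zero, add_zero, zero_add,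
    ContinuousLinearMap.coe_fst', ContinuousLinearMap.coe_snd'] at e0 e1
  -- The `∂_c` entries give the zeroth moment; as `f = a B + c`, the first moment is `a` times
  -- the relation for `∂_a` plus `c` times the relation for `∂_c`.
  obtain ⟨hv0, hv1⟩ := hf.eq_zero_of_moments hn hm h1 h2 (s := v 0) (t := v 1) e1 (by
    rw [sum_orbitWeight_mul_iterate, sum_orbitWeight_mul_iterate]
    linear_combination a * e0 + c * e1)
  apply hv
  ext i
  fin_cases i
  exacts [hv0, hv1]

end

end Bicritical

end

theorem mainTheorem5 (d n m : ℕ) (hn : 1 ≤ n) (hm : 1 ≤ m) :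
    Bicritical.IntersectTransversely (Bicritical.curve₁ d n) (Bicritical.curve₂ d m)
      (Bicritical.Moduli.eqn₁ n) (Bicritical.Moduli.eqn₂ m) :=
  ⟨Bicritical.mem_curve₁_iff, Bicritical.mem_curve₂_iff, fun _ hy =>
    Bicritical.transverseAt_of_eqn_eq_zero hn hm ((Bicritical.mem_curve₁_iff _).mp hy.1)
      ((Bicritical.mem_curve₂_iff _).mp hy.2)⟩
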